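/- Let $K$ be a field of characteristic $0$ and let $A$ be a commutative unital $K$-algebra. Write $\mathrm{Der}(A)$ for the $A$-module of $K$-linear derivations of $A$ and $V^\bullet(A)=S_A(\Sigma\,\mathrm{Der}(A))=\bigwedge_A^\bullet \mathrm{Der}(A)$ for the graded commutative algebra of polyvector fields ($V^0=A$, $V^1=\mathrm{Der}(A)$). With the Schouten–Nijenhuis bracket $[\,,\,]_{SN}$ (the unique graded Lie bracket of degree $-1$ satisfying the graded Leibniz rule with $[a,b]=0$, $[X,a]=X(a)$, $[X,Y]=XY-YX$ for $a,b\in A$, $X,Y\in\mathrm{Der}(A)$) it is a Gerstenhaber algebra. For a Gerstenhaber algebra $(V,\cdot,[\,,\,]_V)$ the bar construction $B_{e_2^\vee}(V)$ is the cofree $e_2^\vee$-coalgebra $$\mathbb F_{e_2^\vee}(V)=\Sigma^2\, S^{\ge 1}\bigl(\Sigma^{-1}L\bigr),\qquad L=\mathbb F_{\mathrm{colie}}(\Sigma^{-1}V)=T^{\ge1}(\Sigma^{-1}V)\big/\bigl(T^{\ge1}(\Sigma^{-1}V)\bullet_{sh}T^{\ge1}(\Sigma^{-1}V)\bigr),$$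 where $\Sigma^{-1}$ lowers degrees by one, $\bullet_{sh}$ is the shuffle product with Koszul signs and $S$ is the graded symmetric power, with the following codifferential $d_V$. First, $L$ carries the coderivation $\delta$ whose corestriction to $V$ is the product, $(P_1,P_2)\mapsto(-1)^{|P_1|}P_1\cdot P_2$ on words of length two and zero on all other words, where $|P_1|$ is the degree of $P_1$ in $V$. Secondly, $L$ carries the Lie bracket $[\,,\,]$ determined by $u([X,Y])=[u(X),u(Y)]_V$, where $u\colon L\to V$ is the corestriction, and by compatibility with the Lie cobracket of $L$. Explicitly, it is induced by sending two words to the sum of all their signed shuffles in which one letter $x$ of the first word is immediately followed by a letter $y$ of the second one and the two are replaced by the letter $[x,y]_V$. Finally, $d_V$ is the Chevalley–Eilenberg codifferential of the DG Lie algebra $(L,\delta,[\,,\,])$: the coderivation of the symmetric coalgebra $S^{\ge1}(\Sigma^{-1}L)$ whose components are $X\mapsto\delta X$ and $(X,Y)\mapsto-(-1)^{|X|}[X,Y]$, where $|X|$ is the degree in $L$. Let $\Xi(A)\subset\mathbb F_{e_2^\vee}(V^\bullet(A))$ be the linear span of all nonempty symmetric products $X_1\cdots X_k$ in which every $X_i\in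 L$ is the class of a word with letters in $A\oplus\mathrm{Der}(A)\subset V^\bullet(A)$ in which an element of $\mathrm{Der}(A)$ appears at most once. Then $\Xi(A)$ is stable under the codifferential of $B_{e_2^\vee}(V^\bullet(A))$: $$d_{V^\bullet(A)}(\Xi(A))\subset\Xi(A).$$ -/

import Mathlib

namespace Gerst

section Schouten
open ExteriorAlgebra

variable (K A : Type*) [Field K] [CommRing A] [Algebra K A]

/-- Polyvector fields: the (graded) symmetric algebra over `A` of the module `Der_K(A)` placed in
degree one. -/
abbrev Polyvec := ExteriorAlgebra A (Derivation K A A)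

-- Shortcuts for instance search.
noncomputable instance : Ring (Polyvec K A) := inferInstance
noncomputable instance : Semiring (Polyvec K A) := inferInstance
noncomputable instance : NonUnitalNonAssocSemiring (Polyvec K A) := inferInstance
noncomputable instance : NonUnitalNonAssocRing (Polyvec K A) := inferInstance
noncomputable instance : AddCommGroup (Polyvec K A) := inferInstance
noncomputable instance : AddCommMonoid (Polyvec K A) := inferInstance
noncomputable instance : AddMonoid (Polyvec K A) := inferInstance
noncomputable instance : AddZeroClass (Polyvec K A) := inferInstance
noncomputable instance : Add (Polyvec K A) := inferInstance
noncomputable instance : Mul (Polyvec K A) := inferInstance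
noncomputable instance : Neg (Polyvec K A) := inferInstance
noncomputable instance : Algebra K (Polyvec K A) := inferInstance
noncomputable instance : Algebra A (Polyvec K A) := inferInstance
noncomputable instance : Module K (Polyvec K A) := inferInstance
noncomputable instance : SMul K (Polyvec K A) := inferInstance
noncomputable instance : IsScalarTower K (Polyvec K A) (Polyvec K A) := inferInstance
noncomputable instance : SMulCommClass K (Polyvec K A) (Polyvec K A) := inferInstance

/-- The degree `n` component of the polyvector fields, as a `K`-subspace. -/
noncomputable def polyvecDeg (n : ℕ) : Submodule K (Polyvec K A) :=
  (⋀[A]^n (Derivation K A A)).restrictScalars K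

noncomputable instance : GradedAlgebra (polyvecDeg K A) where
  one_mem := SetLike.GradedOne.one_mem (A := fun i : ℕ => ⋀[A]^i (Derivation K A A))
  mul_mem _ _ _ _ hx hy :=
    SetLike.GradedMul.mul_mem (A := fun i : ℕ => ⋀[A]^i (Derivation K A A)) hx hy
  decompose' := fun x => DirectSum.decompose (fun i : ℕ => ⋀[A]^i (Derivation K A A)) x
  left_inv := DirectSum.Decomposition.left_inv (ℳ := fun i : ℕ => ⋀[A]^i (Derivation K A A))
  right_inv := DirectSum.Decomposition.right_inv (ℳ := fun i : ℕ => ⋀[A]^i (Derivation K A A))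

variable {K A}

set_option maxHeartbeats 1000000 in
theorem polyvec_ext_der {N : Type*} [AddCommGroup N] [Module K N]
    (l r : Polyvec K A →ₗ[K] Module.End K N)
    (l1 : l 1 = 1) (lmul : ∀ w w', l (w * w') = l w * l w')
    (rmul : ∀ w w', r (w * w') = r w' * r w) (lr : ∀ w w', l w * r w' = r w' * l w)
    (δ₀ : A →ₗ[K] N) (δ₁ : Derivation K A A →ₗ[K] N)
    (r1 : r 1 = 1)
    (ra : ∀ a, r (algebraMap A _ a) = l (algebraMap A _ a))
    (h00 : ∀ a b, δ₀ (a * b) = l (algebraMap A _ a) (δ₀ b) + l (algebraMap A _ b) (δ₀ a))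
    (h0 : ∀ a w, r w (δ₀ a) = l w (δ₀ a))
    (h1 : ∀ a X, δ₁ (a • X) = l (algebraMap A _ a) (δ₁ X) + l (ι A X) (δ₀ a))
    (h11 : ∀ X, l (ι A X) (δ₁ X) + r (ι A X) (δ₁ X) = 0) :
    ∃ D : Polyvec K A →ₗ[K] N, (∀ w w', D (w * w') = l w (D w') + r w' (D w)) ∧
      (∀ a, D (algebraMap A _ a) = δ₀ a) ∧ ∀ X, D (ι A X) = δ₁ X := by
  have rl1 : l 1 = LinearMap.id := l1
  have rr1 : r 1 = LinearMap.id := r1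
  let E : Polyvec K A × N →ₗ[K] Module.End K (Polyvec K A × N) :=
    { toFun := fun p =>
        { toFun := fun q => (p.1 * q.1, l p.1 q.2 + r q.1 p.2)
          map_add' := fun x y => by ext <;> simp [mul_add]; abel
          map_smul' := fun c x => by ext <;> simp }
      map_add' := fun x y => by
        apply LinearMap.ext; intro q; ext <;> simp [add_mul]; abel
      map_smul' := fun c x => by
        apply LinearMap.ext; intro q; ext <;> simp }
  have hE : ∀ p q, E p q = (p.1 * q.1, l p.1 q.2 + r q.1 p.2) := fun _ _ => rfl
  have hE0 : E (0, 0) = 0 := by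
    apply LinearMap.ext; intro z; ext <;> simp [hE]
  have lr' : ∀ w w' n, l w (r w' n) = r w' (l w n) := fun w w' n =>
    LinearMap.congr_fun (lr w w') n
  have hmul : ∀ p q, E p * E q = E (p.1 * q.1, l p.1 q.2 + r q.1 p.2) := by
    intro p q
    apply LinearMap.ext; intro z
    ext
    · simp [hE, mul_assoc]
    · simp [hE, lmul, rmul, lr', add_assoc]
  have h0one : δ₀ 1 = 0 := by
    have := h00 1 1
    simpa [rl1] using this
  have hE1 : E (1, 0) = 1 := by
    apply LinearMap.ext; intro z; ext <;> simp [hE, rl1]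
  let ψ : A →+* Module.End K (Polyvec K A × N) :=
    { toFun := fun a => E (algebraMap A _ a, δ₀ a)
      map_one' := by simp only [map_one, h0one, hE1]
      map_mul' := fun a b => by
        rw [hmul, map_mul, h00, ra]
      map_zero' := by rw [map_zero, map_zero, hE0]
      map_add' := fun a b => by simp only [← map_add, Prod.mk_add_mk] }
  have hψ : ∀ a, ψ a = E (algebraMap A _ a, δ₀ a) := fun _ => rfl
  have hEsmul : ∀ a X, ψ a * E (ι A X, δ₁ X) = E (ι A (a • X), δ₁ (a • X)) := by
    intro a X
    rw [hψ, hmul, h1, map_smul, Algebra.smul_def, h0]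
  let C : Subring (Module.End K (Polyvec K A × N)) := Subring.centralizer (Set.range ψ)
  have hC : ∀ a, ψ a ∈ C := by
    intro a
    rw [Subring.mem_centralizer_iff]
    rintro _ ⟨b, rfl⟩
    rw [← map_mul, ← map_mul, mul_comm]
  let ψ' : A →+* C := ψ.codRestrict C hC
  let _ : Algebra A C := ψ'.toAlgebra' (by
    intro a c
    apply Subtype.ext
    exact (Subring.mem_centralizer_iff.1 c.2) _ ⟨a, rfl⟩)
  have hsmul : ∀ (a : A) (c : C), ((a • c : C) : Module.End K (Polyvec K A × N)) = ψ a * c :=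
    fun _ _ => rfl
  have halg : ∀ (a : A), ((algebraMap A C a : C) : Module.End K (Polyvec K A × N)) = ψ a :=
    fun _ => rfl
  let f : Derivation K A A →ₗ[A] C :=
    { toFun := fun X => ⟨E (ι A X, δ₁ X), by
        rw [Subring.mem_centralizer_iff]
        rintro _ ⟨b, rfl⟩
        rw [hψ, hmul, hmul]
        dsimp only
        rw [Algebra.commutes b (ι A X), h0, ra, add_comm]⟩
      map_add' := fun X Y => by
        apply Subtype.ext
        simp only [Subring.coe_add, ← map_add, Prod.mk_add_mk]
      map_smul' := fun a X => Subtype.ext (hEsmul a X).symm }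
  have hf : ∀ X, ((f X : C) : Module.End K (Polyvec K A × N)) = E (ι A X, δ₁ X) := fun _ => rfl
  have hff : ∀ X, f X * f X = 0 := by
    intro X
    apply Subtype.ext
    rw [Subring.coe_mul, hf, hmul]
    exact (congrArg E (Prod.ext (ExteriorAlgebra.ι_sq_zero X) (h11 X))).trans hE0
  let F : Polyvec K A →ₐ[A] C := ExteriorAlgebra.lift A ⟨f, hff⟩
  obtain ⟨G, hGmul, hGadd, hGι, hGa⟩ : ∃ G : Polyvec K A → Module.End K (Polyvec K A × N),
      (∀ a b, G (a * b) = G a * G b) ∧ (∀ a b, G (a + b) = G a + G b) ∧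
      (∀ X, G (ι A X) = E (ι A X, δ₁ X)) ∧
      (∀ a, G (algebraMap A _ a) = E (algebraMap A _ a, δ₀ a)) :=
    ⟨fun w => (F w).1, fun a b => congrArg Subtype.val (F.map_mul a b),
      fun a b => congrArg Subtype.val (F.map_add a b),
      fun X => congrArg Subtype.val (ExteriorAlgebra.lift_ι_apply A f hff X),
      fun a => congrArg Subtype.val (F.commutes a)⟩
  have hF : ∀ w, ∃ n, G w = E (w, n) := by
    intro w
    induction w using ExteriorAlgebra.induction with
    | algebraMap a => exact ⟨_, hGa a⟩
    | ι X => exact ⟨_, hGι X⟩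
    | mul a b ha hb =>
      obtain ⟨n, hn⟩ := ha
      obtain ⟨m, hm⟩ := hb
      exact ⟨_, by rw [hGmul, hn, hm, hmul]⟩
    | add a b ha hb =>
      obtain ⟨n, hn⟩ := ha
      obtain ⟨m, hm⟩ := hb
      exact ⟨n + m, by rw [hGadd, hn, hm, ← map_add, Prod.mk_add_mk]⟩
  choose D hD using hF
  have hED : ∀ v n, (E (v, n) (1, 0)).2 = n := by
    intro v n; simp [hE, rr1]
  have hD' : ∀ w, D w = (G w (1, 0)).2 := by
    intro w; rw [hD, hED]
  have hDa : ∀ a, D (algebraMap A _ a) = δ₀ a := by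
    intro a; rw [hD', hGa, hED]
  have hDmul : ∀ w w', D (w * w') = l w (D w') + r w' (D w) := by
    intro w w'
    rw [hD', hGmul, hD, hD, hmul, hED]
  have h0alg : ∀ k : K, δ₀ (algebraMap K A k) = 0 := by
    intro k
    rw [Algebra.algebraMap_eq_smul_one, map_smul, h0one, smul_zero]
  refine ⟨{ toFun := D, map_add' := ?_, map_smul' := ?_ }, hDmul, hDa, ?_⟩
  · intro x y
    rw [hD', hD', hD', hGadd]; rfl
  · intro k x
    have : k • x = algebraMap A _ (algebraMap K A k) * x := by
      rw [← Algebra.smul_def, algebraMap_smul]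
    rw [this, hDmul, hDa, h0alg, map_zero, add_zero]
    have h2 : algebraMap A (Polyvec K A) (algebraMap K A k) = k • 1 := by
      rw [Algebra.algebraMap_eq_smul_one, algebraMap_smul]
    rw [h2, map_smul, rl1]; rfl
  · intro X; change D _ = _; rw [hD', hGι, hED]

end Schouten

section Schouten
open ExteriorAlgebra
variable {K A : Type*} [Field K] [CommRing A] [Algebra K A]

theorem alg_mem (a : A) : algebraMap A (Polyvec K A) a ∈ polyvecDeg K A 0 := by
  change _ ∈ (LinearMap.range (ι A : Derivation K A A →ₗ[A] Polyvec K A)) ^ 0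
  rw [pow_zero]; exact Submodule.algebraMap_mem a

theorem ι_mem (X : Derivation K A A) : ι A X ∈ polyvecDeg K A 1 := by
  change _ ∈ (LinearMap.range (ι A : Derivation K A A →ₗ[A] Polyvec K A)) ^ 1
  rw [pow_one]; exact ⟨X, rfl⟩

theorem pmul_mem {p q r : ℕ} {x y : Polyvec K A} (hx : x ∈ polyvecDeg K A p)
    (hy : y ∈ polyvecDeg K A q) (h : p + q = r) : x * y ∈ polyvecDeg K A r :=
  h ▸ SetLike.GradedMul.mul_mem hx hy

theorem polyvec_induction {C : ∀ (n : ℕ) (x : Polyvec K A), x ∈ polyvecDeg K A n → Prop}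
    (alg : ∀ a, C 0 (algebraMap A _ a) (alg_mem a))
    (add : ∀ n x y hx hy, C n x hx → C n y hy → C n (x + y) (add_mem hx hy))
    (mul : ∀ n X x hx, C n x hx → C (n + 1) (ι A X * x) (pmul_mem (ι_mem X) hx (add_comm 1 n)))
    {n : ℕ} {x : Polyvec K A} (hx : x ∈ polyvecDeg K A n) : C n x hx := by
  refine Submodule.pow_induction_on_left' (LinearMap.range (ι A : Derivation K A A →ₗ[A] Polyvec K A))
    (C := fun n x hx => C n x hx) alg (fun x y i hx hy => add i x y hx hy) ?_ hx
  rintro _ ⟨X, rfl⟩ i x hx h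
  exact mul i X x hx h

theorem ι_comm (X : Derivation K A A) {q : ℕ} {y : Polyvec K A} (hy : y ∈ polyvecDeg K A q) :
    ι A X * y = (-1 : K) ^ q • (y * ι A X) := by
  induction hy using polyvec_induction with
  | alg a => rw [pow_zero, one_smul, Algebra.commutes]
  | add n x y _ _ h1 h2 => rw [mul_add, h1, h2, add_mul, smul_add]
  | mul n Y x _ h =>
    have : ι A X * ι A Y = - (ι A Y * ι A X) := eq_neg_of_add_eq_zero_left (ι_add_mul_swap X Y)
    rw [← mul_assoc, this, neg_mul, mul_assoc, h, pow_succ, mul_smul_comm]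
    simp [mul_assoc]

theorem polyvec_comm {p q : ℕ} {x y : Polyvec K A} (hx : x ∈ polyvecDeg K A p)
    (hy : y ∈ polyvecDeg K A q) : x * y = (-1 : K) ^ (p * q) • (y * x) := by
  induction hx using polyvec_induction with
  | alg a => rw [zero_mul, pow_zero, one_smul, Algebra.commutes]
  | add n x y _ _ h1 h2 => rw [add_mul, h1, h2, mul_add, smul_add]
  | mul n X x _ h =>
    rw [mul_assoc, h, mul_smul_comm, ← mul_assoc, ι_comm X hy, smul_mul_assoc, smul_smul,
      add_mul, one_mul, pow_add, mul_assoc]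

/-- The grading involution, `(-1)^p` on degree `p`. -/
noncomputable def sg : Polyvec K A →ₗ[K] Polyvec K A :=
  (CliffordAlgebra.involute (Q := (0 : QuadraticForm A (Derivation K A A)))).toLinearMap.restrictScalars K

theorem sg_mul (x y : Polyvec K A) : sg (x * y) = sg x * sg y :=
  map_mul (CliffordAlgebra.involute (Q := (0 : QuadraticForm A (Derivation K A A)))) x y

theorem sg_eq {p : ℕ} {x : Polyvec K A} (hx : x ∈ polyvecDeg K A p) : sg x = (-1 : K) ^ p • x := by
  induction hx using polyvec_induction with
  | alg a =>
    rw [pow_zero, one_smul]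
    exact AlgHom.commutes (CliffordAlgebra.involute (Q := (0 : QuadraticForm A (Derivation K A A)))) a
  | add n x y _ _ h1 h2 => rw [map_add, h1, h2, smul_add]
  | mul n X x _ h =>
    have : sg (ι A X) = - ι A X := CliffordAlgebra.involute_ι X
    rw [sg_mul, h, this, pow_succ]; simp

theorem polyvec_hom_span (C : Polyvec K A → Prop) (hadd : ∀ x y, C x → C y → C (x + y))
    (h0 : C 0) (h : ∀ n, ∀ x ∈ polyvecDeg K A n, C x) (x : Polyvec K A) : C x := by
  classical
  rw [← DirectSum.sum_support_decompose (polyvecDeg K A) x]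
  exact Finset.sum_induction _ C hadd h0 fun i _ => h i _ (SetLike.coe_mem _)

theorem exists_lieDer : ∃ L : Derivation K A A →ₗ[K] Module.End K (Polyvec K A),
    (∀ X Q Q', L X (Q * Q') = Q * L X Q' + L X Q * Q') ∧
    (∀ X a, L X (algebraMap A _ a) = algebraMap A _ (X a)) ∧
    (∀ X Y, L X (ι A Y) = ι A ⁅X, Y⁆) := by
  obtain ⟨D, hD, hDa, hDX⟩ := polyvec_ext_der (K := K) (A := A)
    (N := Derivation K A A →ₗ[K] Polyvec K A)
    ((LinearMap.llcomp K (Derivation K A A) (Polyvec K A) (Polyvec K A)).comp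
      (LinearMap.mul K (Polyvec K A)))
    ((LinearMap.llcomp K (Derivation K A A) (Polyvec K A) (Polyvec K A)).comp
      (LinearMap.mul K (Polyvec K A)).flip)
    (by ext; simp) (by intros; ext; simp [mul_assoc]) (by intros; ext; simp [mul_assoc])
    (by intros; ext; simp [mul_assoc])
    { toFun := fun a =>
        { toFun := fun X => algebraMap A _ (X a)
          map_add' := fun X Y => by simp
          map_smul' := fun c X => by
            simp [Algebra.algebraMap_eq_smul_one] }
      map_add' := fun a b => by ext; simp
      map_smul' := fun c a => by ext; simp [Algebra.algebraMap_eq_smul_one] }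
    { toFun := fun Y =>
        { toFun := fun X => ι A ⁅X, Y⁆
          map_add' := fun X X' => by rw [add_lie, map_add]
          map_smul' := fun c X => by
            rw [smul_lie, ← algebraMap_smul A c, map_smul, algebraMap_smul]; rfl }
      map_add' := fun a b => by ext; simp
      map_smul' := fun c a => by
        ext X
        change ι A ⁅X, c • a⁆ = c • ι A ⁅X, a⁆
        have : ⁅X, c • a⁆ = algebraMap K A c • ⁅X, a⁆ := by
          ext b
          simp [Derivation.commutator_apply, Algebra.smul_def, mul_sub]
        rw [this, map_smul, algebraMap_smul] }
    (by ext; simp) (by intros; ext; simp [Algebra.commutes])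
    (by intros; ext; simp)
    (by intros; ext; simp [Algebra.commutes])
    (by
      intro a Y; ext X
      simp [← Algebra.smul_def, ← Algebra.commutes])
    (by
      intro Y; ext X
      simp)
  refine ⟨D.flip, ?_, ?_, ?_⟩
  · intro X Q Q'
    simp [hD]
  · intro X a; simp [hDa]
  · intro X Y; simp [hDX]

/-- The derivative of a function, as a linear form on derivations. -/
noncomputable def dform (a : A) : Module.Dual A (Derivation K A A) where
  toFun X := X a
  map_add' _ _ := rfl
  map_smul' _ _ := rfl

/-- Contraction with the derivative of a function. -/
noncomputable def ctr : A →ₗ[K] Module.End K (Polyvec K A) where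
  toFun a := (CliffordAlgebra.contractLeft (Q := (0 : QuadraticForm A (Derivation K A A)))
    (dform a)).restrictScalars K
  map_add' a b := by
    have : dform (K := K) (a + b) = dform a + dform b := by ext X; simp [dform]
    rw [this, map_add]; rfl
  map_smul' c a := by
    have : dform (K := K) (c • a) = algebraMap K A c • dform a := by
      ext X; simp [dform, Algebra.smul_def]
    rw [this, map_smul]
    ext x
    simp

theorem ctr_alg (a b : A) : ctr (K := K) a (algebraMap A _ b) = 0 :=
  CliffordAlgebra.contractLeft_algebraMap (0 : QuadraticForm A (Derivation K A A)) (dform a) b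

theorem ctr_mul (a : A) (X : Derivation K A A) (w : Polyvec K A) :
    ctr a (ι A X * w) = algebraMap A _ (X a) * w - ι A X * ctr a w := by
  rw [← Algebra.smul_def]
  exact CliffordAlgebra.contractLeft_ι_mul (Q := (0 : QuadraticForm A (Derivation K A A))) (d := dform a) X w

theorem ctr_prod (a b : A) (w : Polyvec K A) :
    ctr (a * b) w = algebraMap A _ a * ctr b w + algebraMap A _ b * ctr a w := by
  have : dform (K := K) (a * b) = a • dform b + b • dform a := by
    ext X; simp [dform]
  change CliffordAlgebra.contractLeft (Q := (0 : QuadraticForm A (Derivation K A A))) (dform (a * b)) w = _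
  rw [this, map_add, map_smul, map_smul, ← Algebra.smul_def, ← Algebra.smul_def]
  rfl

theorem ctr_mem (a : A) {q : ℕ} {y : Polyvec K A} (hy : y ∈ polyvecDeg K A q) :
    (q = 0 → ctr a y = 0) ∧ ∀ r, r + 1 = q → ctr a y ∈ polyvecDeg K A r := by
  induction hy using polyvec_induction with
  | alg b => exact ⟨fun _ => ctr_alg a b, fun r h => by omega⟩
  | add n x y _ _ h1 h2 =>
    refine ⟨fun h => by rw [map_add, h1.1 h, h2.1 h, add_zero], fun r h => ?_⟩
    rw [map_add]; exact add_mem (h1.2 r h) (h2.2 r h)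
  | mul n X x hx h =>
    refine ⟨fun h => by omega, fun r hr => ?_⟩
    obtain rfl : r = n := by omega
    rw [ctr_mul]
    refine sub_mem (pmul_mem (alg_mem _) hx (zero_add _)) ?_
    rcases Nat.eq_zero_or_pos r with h0 | h0
    · rw [h.1 h0, mul_zero]; exact zero_mem _
    · exact pmul_mem (ι_mem X) (h.2 (r - 1) (by omega)) (by omega)

theorem ctr_sg (a : A) (Q : Polyvec K A) : ctr a (sg Q) = - sg (ctr a Q) := by
  induction Q using polyvec_hom_span with
  | hadd x y h1 h2 => simp only [map_add, h1, h2, neg_add]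
  | h0 => simp
  | h n x hx =>
    rw [sg_eq hx, map_smul]
    rcases n with _ | n
    · rw [(ctr_mem a hx).1 rfl]; simp
    · rw [sg_eq ((ctr_mem a hx).2 n rfl), pow_succ]; simp

theorem lieDer_mem {L : Derivation K A A →ₗ[K] Module.End K (Polyvec K A)}
    (hm : ∀ X Q Q', L X (Q * Q') = Q * L X Q' + L X Q * Q')
    (ha : ∀ X a, L X (algebraMap A _ a) = algebraMap A _ (X a))
    (hX : ∀ X Y, L X (ι A Y) = ι A ⁅X, Y⁆) (X : Derivation K A A)
    {q : ℕ} {y : Polyvec K A} (hy : y ∈ polyvecDeg K A q) : L X y ∈ polyvecDeg K A q := by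
  induction hy using polyvec_induction with
  | alg b => rw [ha]; exact alg_mem _
  | add n x y _ _ h1 h2 => rw [map_add]; exact add_mem h1 h2
  | mul n Y x hx h =>
    rw [hm, hX]
    exact add_mem (pmul_mem (ι_mem _) h (add_comm _ _)) (pmul_mem (ι_mem _) hx (add_comm _ _))

variable [CharZero K]

set_option maxHeartbeats 2000000 in
theorem exists_ad : ∃ (L : Derivation K A A →ₗ[K] Module.End K (Polyvec K A))
    (br : Polyvec K A →ₗ[K] Module.End K (Polyvec K A)),
    (∀ X Q Q', L X (Q * Q') = Q * L X Q' + L X Q * Q') ∧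
    (∀ X a, L X (algebraMap A _ a) = algebraMap A _ (X a)) ∧
    (∀ X Y, L X (ι A Y) = ι A ⁅X, Y⁆) ∧
    (∀ a Q, br (algebraMap A _ a) Q = - ctr a Q) ∧ (∀ X Q, br (ι A X) Q = L X Q) ∧
    (∀ p q P P' Q, P' ∈ polyvecDeg K A p → Q ∈ polyvecDeg K A q →
      br (P * P') Q = P * br P' Q + (-1 : K) ^ (p * (q + 1)) • (br P Q * P')) := by
  obtain ⟨L, hm, ha, hX⟩ := exists_lieDer (K := K) (A := A)
  have hLmem := fun X q (y : Polyvec K A) (hy : y ∈ polyvecDeg K A q) => lieDer_mem hm ha hX X hy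
  let ev : Module.End K (Polyvec K A) := (2⁻¹ : K) • (1 + sg)
  let od : Module.End K (Polyvec K A) := (2⁻¹ : K) • (1 - sg)
  have hev : ∀ q, ∀ Q ∈ polyvecDeg K A q, ev Q = if Even q then Q else 0 := by
    intro q Q hQ
    simp only [ev, LinearMap.smul_apply, LinearMap.add_apply, Module.End.one_apply, sg_eq hQ]
    split_ifs with h
    · rw [h.neg_one_pow, one_smul, ← two_smul K Q, smul_smul]; simp
    · rw [(Nat.not_even_iff_odd.1 h).neg_one_pow]; simp
  have hod : ∀ q, ∀ Q ∈ polyvecDeg K A q, od Q = if Even q then 0 else Q := by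
    intro q Q hQ
    simp only [od, LinearMap.smul_apply, LinearMap.sub_apply, Module.End.one_apply, sg_eq hQ]
    split_ifs with h
    · rw [h.neg_one_pow, one_smul]; simp
    · rw [(Nat.not_even_iff_odd.1 h).neg_one_pow, neg_one_smul, sub_neg_eq_add, ← two_smul K Q,
        smul_smul]; simp
  let mr : Polyvec K A →ₗ[K] Module.End K (Polyvec K A) := (LinearMap.mul K (Polyvec K A)).flip
  let cp : Module.End K (Polyvec K A) →ₗ[K] Module.End K (Polyvec K A) →ₗ[K]
    Module.End K (Polyvec K A) := LinearMap.mul K (Module.End K (Polyvec K A))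
  let l : Polyvec K A →ₗ[K] Module.End K (Module.End K (Polyvec K A)) :=
    cp.comp (LinearMap.mul K (Polyvec K A))
  let r : Polyvec K A →ₗ[K] Module.End K (Module.End K (Polyvec K A)) :=
    (LinearMap.mulRight K od).compRight K ∘ₗ cp.comp mr
      + (LinearMap.mulRight K ev).compRight K ∘ₗ cp.comp (mr.comp sg)
  have hl : ∀ w n Q, l w n Q = w * n Q := fun _ _ _ => rfl
  have hr : ∀ w n Q, r w n Q = n (od Q) * w + n (ev Q) * sg w := fun _ _ _ => rfl
  have hr' : ∀ p q w n Q, w ∈ polyvecDeg K A p → Q ∈ polyvecDeg K A q →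
      r w n Q = (-1 : K) ^ (p * (q + 1)) • (n Q * w) := by
    intro p q w n Q hw hQ
    rw [hr, hev q Q hQ, hod q Q hQ, sg_eq hw]
    rcases Nat.even_or_odd q with h | h
    · have : (-1 : K) ^ (p * (q + 1)) = (-1) ^ p := by
        rw [mul_comm, pow_mul, (h.add_one).neg_one_pow]
      simp [h, this]
    · have : (-1 : K) ^ (p * (q + 1)) = 1 := by
        rw [mul_comm, pow_mul, (h.add_one).neg_one_pow, one_pow]
      simp [Nat.not_even_iff_odd.2 h, this]
  have hop : ∀ f g : Module.End K (Polyvec K A),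
      (∀ q, ∀ Q ∈ polyvecDeg K A q, f Q = g Q) → f = g := by
    intro f g h
    ext Q
    induction Q using polyvec_hom_span with
    | hadd x y h1 h2 => simp only [map_add, h1, h2]
    | h0 => simp
    | h n x hx => exact h n x hx
  have sg1 : sg (1 : Polyvec K A) = 1 := by
    have := sg_eq (K := K) (A := A) (alg_mem 1)
    simpa using this
  have r_one : ∀ n, r 1 n = n := by
    intro n; apply hop; intro q Q hQ
    rw [hr' 0 q _ _ _ (by simpa using alg_mem (K := K) (1 : A)) hQ]; simp
  obtain ⟨br, hbr, hbra, hbrX⟩ := polyvec_ext_der (K := K) (A := A)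
    (N := Module.End K (Polyvec K A)) l r
    (by ext; simp [hl]) (by intros; ext; simp [hl, mul_assoc])
    (by
      intro w w'; apply LinearMap.ext; intro n
      apply hop; intro q Q hQ
      rw [Module.End.mul_apply, hr, hr, hr, hr]
      rw [hev q Q hQ, hod q Q hQ, sg_mul]
      split_ifs with h
      · simp [hev q Q hQ, hod q Q hQ, h, mul_assoc]
      · simp [hev q Q hQ, hod q Q hQ, h, mul_assoc])
    (by
      intro w w'; apply LinearMap.ext; intro n
      ext Q
      simp [hl, hr, mul_add, mul_assoc])
    (-ctr) L
    (by apply LinearMap.ext; intro n; exact r_one n)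
    (by
      intro a; apply LinearMap.ext; intro n
      apply hop; intro q Q hQ
      rw [hr' 0 q _ _ _ (alg_mem a) hQ, hl, Algebra.commutes]; simp)
    (by
      intro a b; ext Q
      simp only [LinearMap.neg_apply, ctr_prod, hl, LinearMap.add_apply, mul_neg]; abel)
    (by
      intro a w
      induction w using polyvec_hom_span with
      | hadd x y h1 h2 => simp only [map_add, h1, h2, LinearMap.add_apply]
      | h0 => simp
      | h p w hw =>
        apply hop; intro q Q hQ
        rw [hr' p q _ _ _ hw hQ, hl]
        simp only [LinearMap.neg_apply, mul_neg, neg_mul, smul_neg, neg_inj]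
        rcases q with _ | q
        · rw [(ctr_mem a hQ).1 rfl]; simp
        · rw [polyvec_comm hw ((ctr_mem a hQ).2 q rfl)]
          congr 1
          ring_nf
          simp)
    (by
      intro a X
      apply hop; intro q Q hQ
      simp only [LinearMap.add_apply, hl, LinearMap.neg_apply]
      induction hQ using polyvec_induction with
      | alg b => simp [ha, ctr_alg]
      | add n x y _ _ h1 h2 => simp only [map_add, h1, h2, mul_add, neg_add]; abel
      | mul n Y x hx h =>
        have e1 : ⁅a • X, Y⁆ = a • ⁅X, Y⁆ - Y a • X := by
          ext b; simp [Derivation.commutator_apply]; ring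
        have e2 : ι A X * ι A Y = - (ι A Y * ι A X) :=
          eq_neg_of_add_eq_zero_left (ι_add_mul_swap X Y)
        have e3 : ι A X * (ι A Y * ctr a x) = - (ι A Y * (ι A X * ctr a x)) := by
          rw [← mul_assoc, e2, neg_mul, mul_assoc]
        have e4 : ∀ (b : A) (u v : Polyvec K A),
          u * (algebraMap A _ b * v) = algebraMap A _ b * (u * v) := by
          intro b u v
          rw [← mul_assoc, ← Algebra.commutes, mul_assoc]
        rw [hm, hX, h, hm, hX, e1, ctr_mul, map_sub, map_smul, map_smul, Algebra.smul_def,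
          Algebra.smul_def]
        simp only [mul_add, mul_sub, sub_mul, mul_neg, mul_assoc, e3, e4]
        abel)
    (by
      intro X
      apply hop; intro q Q hQ
      rw [LinearMap.add_apply, hl, hr' 1 q _ _ _ (ι_mem X) hQ, ι_comm X (hLmem X q Q hQ),
        pow_mul, pow_succ]
      simp)
  refine ⟨L, br, hm, ha, hX, ?_, ?_, ?_⟩
  · intro a Q; rw [hbra]; rfl
  · intro X Q; rw [hbrX]
  · intro p q P P' Q hP' hQ
    rw [hbr, LinearMap.add_apply, hl, hr' p q _ _ _ hP' hQ]

end Schouten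

section Schouten
open ExteriorAlgebra
variable {K A : Type*} [Field K] [CommRing A] [Algebra K A]

/-- The defining properties of the Schouten-Nijenhuis bracket on polyvector fields: it is the
graded Lie bracket of degree `-1` that extends the commutator of derivations and the action of
derivations on functions and satisfies the graded Leibniz rule. -/
structure IsSchouten (br : Polyvec K A →ₗ[K] Polyvec K A →ₗ[K] Polyvec K A) : Prop where
  alg_alg : ∀ a b : A, br (algebraMap A _ a) (algebraMap A _ b) = 0
  der_alg : ∀ (X : Derivation K A A) (a : A), br (ι A X) (algebraMap A _ a) = algebraMap A _ (X a)
  der_der : ∀ X Y : Derivation K A A, br (ι A X) (ι A Y) = ι A ⁅X, Y⁆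
  mem : ∀ p q r P Q, P ∈ polyvecDeg K A p → Q ∈ polyvecDeg K A q → p + q = r + 1 →
    br P Q ∈ polyvecDeg K A r
  antisymm : ∀ p q P Q, P ∈ polyvecDeg K A p → Q ∈ polyvecDeg K A q →
    br P Q = -((-1 : K) ^ ((p + 1) * (q + 1)) • br Q P)
  leibniz : ∀ p q P Q R, P ∈ polyvecDeg K A p → Q ∈ polyvecDeg K A q →
    br P (Q * R) = br P Q * R + (-1 : K) ^ ((p + 1) * q) • (Q * br P R)

set_option maxHeartbeats 2000000 in
theorem exists_schouten [CharZero K] : ∃ br : Polyvec K A →ₗ[K] Polyvec K A →ₗ[K] Polyvec K A,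
    IsSchouten br := by
  obtain ⟨L, br, hm, ha, hX, hba, hbX, hbr⟩ := exists_ad (K := K) (A := A)
  have hLmem := fun X q (y : Polyvec K A) (hy : y ∈ polyvecDeg K A q) => lieDer_mem hm ha hX X hy
  have key : ∀ X n x, x ∈ polyvecDeg K A n → ∀ q Q, Q ∈ polyvecDeg K A q →
      br (ι A X * x) Q = ι A X * br x Q + (-1 : K) ^ (n * (q + 1)) • (L X Q * x) := by
    intro X n x hx q Q hQ
    rw [hbr n q _ _ _ hx hQ, hbX]
  have hmem : ∀ p q P Q, P ∈ polyvecDeg K A p → Q ∈ polyvecDeg K A q →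
      (p + q = 0 → br P Q = 0) ∧ ∀ r, r + 1 = p + q → br P Q ∈ polyvecDeg K A r := by
    intro p q P Q hP hQ
    induction hP using polyvec_induction with
    | alg a =>
      rw [hba]
      refine ⟨fun h => ?_, fun r hr => ?_⟩
      · rw [(ctr_mem a hQ).1 (by omega), neg_zero]
      · exact neg_mem ((ctr_mem a hQ).2 r (by omega))
    | add n x y hx hy h1 h2 =>
      simp only [map_add, LinearMap.add_apply]
      exact ⟨fun h => by rw [h1.1 h, h2.1 h, add_zero], fun r hr => add_mem (h1.2 r hr) (h2.2 r hr)⟩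
    | mul n X x hx h =>
      refine ⟨fun h => by omega, fun r hr => ?_⟩
      rw [key X n x hx q Q hQ]
      refine add_mem ?_ (Submodule.smul_mem _ _ (pmul_mem (hLmem X q Q hQ) hx (by omega)))
      rcases Nat.eq_zero_or_pos (n + q) with h0 | h0
      · rw [h.1 h0, mul_zero]; exact zero_mem _
      · exact pmul_mem (ι_mem X) (h.2 (n + q - 1) (by omega)) (by omega)
  have leib : ∀ p q q' P Q R, P ∈ polyvecDeg K A p → Q ∈ polyvecDeg K A q →
      R ∈ polyvecDeg K A q' →
      br P (Q * R) = br P Q * R + (-1 : K) ^ ((p + 1) * q) • (Q * br P R) := by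
    intro p q q' P Q R hP hQ hR
    induction hP using polyvec_induction with
    | alg a =>
      simp only [hba]
      induction hQ using polyvec_induction with
      | alg b =>
        have : ctr a (algebraMap A _ b * R) = algebraMap A _ b * ctr (K := K) a R := by
          rw [← Algebra.smul_def, ← Algebra.smul_def]
          exact map_smul (CliffordAlgebra.contractLeft
            (Q := (0 : QuadraticForm A (Derivation K A A))) (dform a)) b R
        simp [this, ctr_alg]
      | add n x y hx hy h1 h2 =>
        simp only [map_add, add_mul, neg_add, h1, h2, smul_add]; abel
      | mul n X x hx h =>
        have h' : ctr a (x * R) = ctr a x * R + (-1 : K) ^ n • (x * ctr a R) := by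
          have := congrArg Neg.neg h
          simpa [add_comm] using this
        rw [mul_assoc, ctr_mul, ctr_mul, h', zero_add, one_mul, pow_succ]
        simp only [mul_add, neg_mul, sub_mul, mul_assoc, mul_smul_comm, mul_neg, smul_neg,
          mul_one, neg_smul]
        abel
    | add n x y hx hy h1 h2 =>
      simp only [map_add, LinearMap.add_apply, add_mul, mul_add, h1, h2, smul_add]; abel
    | mul n X x hx h =>
      rw [key X n x hx _ _ (pmul_mem hQ hR rfl), key X n x hx _ _ hQ, key X n x hx _ _ hR, h, hm]
      have e1 : R * x = (-1 : K) ^ (q' * n) • (x * R) := polyvec_comm hR hx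
      have e2 : ι A X * (Q * br x R) = (-1 : K) ^ q • (Q * (ι A X * br x R)) := by
        rw [← mul_assoc, ι_comm X hQ, smul_mul_assoc, mul_assoc]
      have e3 : ∀ S : Polyvec K A, S * (x * R) = S * ((-1 : K) ^ (q' * n) • (R * x)) := by
        intro S
        rw [polyvec_comm hx hR, mul_comm q' n]
      simp only [mul_add, add_mul, smul_add, mul_smul_comm, smul_mul_assoc, mul_assoc, e2, e3,
        smul_smul, pow_add, pow_mul, mul_one, one_mul, pow_one]
      rcases neg_one_pow_eq_or K n with h1 | h1 <;> rcases neg_one_pow_eq_or K q with h2 | h2 <;>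
        rcases neg_one_pow_eq_or K q' with h3 | h3 <;> simp [h1, h2, h3] <;> abel
  have a1 : ∀ a q Q, Q ∈ polyvecDeg K A q →
      br Q (algebraMap A _ a) = (-1 : K) ^ (q + 1) • ctr a Q := by
    intro a q Q hQ
    induction hQ using polyvec_induction with
    | alg b => rw [hba, ctr_alg, ctr_alg]; simp
    | add n x y hx hy h1 h2 =>
      simp only [map_add, LinearMap.add_apply, h1, h2, smul_add]
    | mul n X x hx h =>
      rw [key X n x hx _ _ (alg_mem a), h, ctr_mul, ha]
      simp only [smul_sub, mul_smul_comm, pow_succ, zero_add, mul_one, pow_zero]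
      simp [sub_eq_add_neg, add_comm]
  have a2 : ∀ X q Q, Q ∈ polyvecDeg K A q → br Q (ι A X) = - L X Q := by
    intro X q Q hQ
    induction hQ using polyvec_induction with
    | alg b =>
      have := ctr_mul b X 1
      have h1 : ctr b (1 : Polyvec K A) = 0 := by simpa using ctr_alg (K := K) b 1
      rw [h1] at this
      rw [hba, ha]; simpa using this
    | add n x y hx hy h1 h2 =>
      simp only [map_add, LinearMap.add_apply, h1, h2, neg_add]
    | mul n Y x hx h =>
      rw [key Y n x hx _ _ (ι_mem X), h, hm, hX, hX]
      have : (-1 : K) ^ (n * (1 + 1)) = 1 := by rw [mul_comm, pow_mul]; simp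
      have e : ι A ⁅Y, X⁆ = -ι A ⁅X, Y⁆ := by rw [← map_neg, lie_skew]
      rw [this, e]; simp only [mul_neg, neg_mul, one_smul, neg_add]
  refine ⟨br, ⟨?_, ?_, ?_, ?_, ?_, ?_⟩⟩
  · intro a b; rw [hba, ctr_alg, neg_zero]
  · intro X a; rw [hbX, ha]
  · intro X Y; rw [hbX, hX]
  · intro p q r P Q hP hQ h; exact (hmem p q P Q hP hQ).2 r h.symm
  · intro p q P Q hP hQ
    induction hP using polyvec_induction with
    | alg a =>
      rw [hba, a1 a q Q hQ, smul_smul, ← pow_add]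
      have : (-1 : K) ^ ((0 + 1) * (q + 1) + (q + 1)) = 1 := by
        rw [zero_add, one_mul, ← two_mul, pow_mul]; simp
      rw [this, one_smul]
    | add n x y hx hy h1 h2 =>
      simp only [map_add, LinearMap.add_apply, h1, h2, neg_add, smul_add]
    | mul n X x hx h =>
      rw [key X n x hx q Q hQ, leib q 1 n Q _ _ hQ (ι_mem X) hx, a2 X q Q hQ, h]
      simp only [smul_add, mul_smul_comm, smul_smul, mul_neg, neg_mul, smul_neg]
      simp only [pow_add, pow_mul, mul_add, add_mul, one_mul, mul_one, pow_one]
      rcases neg_one_pow_eq_or K n with h1 | h1 <;> rcases neg_one_pow_eq_or K q with h2 | h2 <;>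
        simp [h1, h2] <;> abel
  · intro p q P Q R hP hQ
    induction R using polyvec_hom_span with
    | hadd x y h1 h2 => simp only [map_add, h1, h2, mul_add, smul_add]; abel
    | h0 => simp
    | h n x hx => exact leib p q n P Q x hP hQ hx

theorem IsSchouten.unique {b₁ b₂ : Polyvec K A →ₗ[K] Polyvec K A →ₗ[K] Polyvec K A}
    (h₁ : IsSchouten b₁) (h₂ : IsSchouten b₂) : b₁ = b₂ := by
  have step : ∀ p P, P ∈ polyvecDeg K A p →
      (∀ a, b₁ P (algebraMap A _ a) = b₂ P (algebraMap A _ a)) →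
      (∀ X, b₁ P (ι A X) = b₂ P (ι A X)) → ∀ q Q, Q ∈ polyvecDeg K A q → b₁ P Q = b₂ P Q := by
    intro p P hP ha hX q Q hQ
    induction hQ using polyvec_induction with
    | alg a => exact ha a
    | add n x y hx hy h1 h2 => simp only [map_add, h1, h2]
    | mul n X x hx h =>
      rw [h₁.leibniz p 1 P _ x hP (ι_mem X), h₂.leibniz p 1 P _ x hP (ι_mem X), hX, h]
  have flip : ∀ p q P Q, P ∈ polyvecDeg K A p → Q ∈ polyvecDeg K A q → b₁ Q P = b₂ Q P →
      b₁ P Q = b₂ P Q := by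
    intro p q P Q hP hQ h
    rw [h₁.antisymm p q P Q hP hQ, h₂.antisymm p q P Q hP hQ, h]
  have main : ∀ p P, P ∈ polyvecDeg K A p → ∀ q Q, Q ∈ polyvecDeg K A q → b₁ P Q = b₂ P Q := by
    intro p P hP
    refine step p P hP (fun a => ?_) (fun X => ?_)
    · refine flip p 0 _ _ hP (alg_mem a) (step 0 _ (alg_mem a) (fun b => ?_) (fun Y => ?_) p P hP)
      · rw [h₁.alg_alg, h₂.alg_alg]
      · refine flip 0 1 _ _ (alg_mem a) (ι_mem Y) ?_
        rw [h₁.der_alg, h₂.der_alg]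
    · refine flip p 1 _ _ hP (ι_mem X) (step 1 _ (ι_mem X) (fun b => ?_) (fun Y => ?_) p P hP)
      · rw [h₁.der_alg, h₂.der_alg]
      · rw [h₁.der_der, h₂.der_der]
  ext P Q
  induction P using polyvec_hom_span with
  | hadd x y h1 h2 => simp only [map_add, LinearMap.add_apply, h1, h2]
  | h0 => simp
  | h n P hP =>
    induction Q using polyvec_hom_span with
    | hadd x y h1 h2 => simp only [map_add, h1, h2]
    | h0 => simp
    | h m Q hQ => exact main n P hP m Q hQ

variable (K A) in
/-- The Schouten-Nijenhuis bracket on polyvector fields. -/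
noncomputable def schouten [CharZero K] : Polyvec K A →ₗ[K] Polyvec K A →ₗ[K] Polyvec K A :=
  Classical.choose (exists_schouten (K := K) (A := A))

theorem schouten_spec [CharZero K] : IsSchouten (schouten K A) :=
  Classical.choose_spec (exists_schouten (K := K) (A := A))

section Jacobi
variable {br : Polyvec K A →ₗ[K] Polyvec K A →ₗ[K] Polyvec K A}

theorem IsSchouten.zero (h : IsSchouten br) {P Q : Polyvec K A} (hP : P ∈ polyvecDeg K A 0)
    (hQ : Q ∈ polyvecDeg K A 0) : br P Q = 0 := by
  change P ∈ (LinearMap.range (ι A : Derivation K A A →ₗ[A] Polyvec K A)) ^ 0 at hP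
  change Q ∈ (LinearMap.range (ι A : Derivation K A A →ₗ[A] Polyvec K A)) ^ 0 at hQ
  rw [pow_zero, Submodule.mem_one] at hP hQ
  obtain ⟨a, rfl⟩ := hP
  obtain ⟨b, rfl⟩ := hQ
  exact h.alg_alg a b

theorem IsSchouten.antisymm' (h : IsSchouten br) {p q r : ℕ} {P Q R : Polyvec K A} (hP : P ∈ polyvecDeg K A p)
    (hQ : Q ∈ polyvecDeg K A q) (hR : R ∈ polyvecDeg K A r) :
    br (br P Q) R = -((-1 : K) ^ ((p + q) * (r + 1)) • br R (br P Q)) := by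
  rcases Nat.eq_zero_or_pos (p + q) with h0 | h0
  · obtain ⟨rfl, rfl⟩ : p = 0 ∧ q = 0 := by omega
    rw [h.zero hP hQ]; simp
  · have := h.antisymm (p + q - 1) r _ _ (h.mem p q (p + q - 1) P Q hP hQ (by omega)) hR
    rwa [Nat.sub_add_cancel h0] at this

theorem IsSchouten.leibniz' (h : IsSchouten br) {p q r : ℕ} {P Q R : Polyvec K A} (S : Polyvec K A)
    (hP : P ∈ polyvecDeg K A p)
    (hQ : Q ∈ polyvecDeg K A q) (hR : R ∈ polyvecDeg K A r) :
    br (br P Q) (R * S) = br (br P Q) R * S + (-1 : K) ^ ((p + q) * r) • (R * br (br P Q) S) := by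
  rcases Nat.eq_zero_or_pos (p + q) with h0 | h0
  · obtain ⟨rfl, rfl⟩ : p = 0 ∧ q = 0 := by omega
    rw [h.zero hP hQ]; simp
  · have := h.leibniz (p + q - 1) r _ _ S (h.mem p q (p + q - 1) P Q hP hQ (by omega)) hR
    rwa [Nat.sub_add_cancel h0] at this

theorem IsSchouten.jacobi_step (h : IsSchouten br) {p q : ℕ} {P Q : Polyvec K A} (hP : P ∈ polyvecDeg K A p)
    (hQ : Q ∈ polyvecDeg K A q)
    (ha : ∀ a, br P (br Q (algebraMap A _ a)) = br (br P Q) (algebraMap A _ a) +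
      (-1 : K) ^ ((p + 1) * (q + 1)) • br Q (br P (algebraMap A _ a)))
    (hX : ∀ X, br P (br Q (ι A X)) = br (br P Q) (ι A X) +
      (-1 : K) ^ ((p + 1) * (q + 1)) • br Q (br P (ι A X)))
    {r : ℕ} {R : Polyvec K A} (hR : R ∈ polyvecDeg K A r) :
    br P (br Q R) = br (br P Q) R + (-1 : K) ^ ((p + 1) * (q + 1)) • br Q (br P R) := by
  induction hR using polyvec_induction with
  | alg a => exact ha a
  | add n x y hx hy h1 h2 => simp only [map_add, h1, h2, smul_add]; abel
  | mul n X x hx ih =>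
    rw [h.leibniz q 1 Q _ x hQ (ι_mem X), h.leibniz p 1 P _ x hP (ι_mem X),
      h.leibniz' x hP hQ (ι_mem X)]
    simp only [map_add, map_smul]
    rw [h.leibniz p q P _ x hP (h.mem q 1 q _ _ hQ (ι_mem X) rfl),
      h.leibniz q p Q _ x hQ (h.mem p 1 p _ _ hP (ι_mem X) rfl),
      h.leibniz q 1 Q _ _ hQ (ι_mem X), h.leibniz p 1 P _ _ hP (ι_mem X), ih, hX]
    simp only [smul_add, add_mul, mul_add, smul_smul, mul_smul_comm, smul_mul_assoc,
      pow_add, pow_mul, mul_one, one_mul, pow_one]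
    rcases neg_one_pow_eq_or K p with h1 | h1 <;> rcases neg_one_pow_eq_or K q with h2 | h2 <;>
      simp [h1, h2] <;> abel

theorem IsSchouten.jacobi_rot (h : IsSchouten br) {p q r : ℕ} {P Q R : Polyvec K A} (hP : P ∈ polyvecDeg K A p)
    (hQ : Q ∈ polyvecDeg K A q) (hR : R ∈ polyvecDeg K A r)
    (hJ : br P (br Q R) = br (br P Q) R + (-1 : K) ^ ((p + 1) * (q + 1)) • br Q (br P R)) :
    br R (br P Q) = br (br R P) Q + (-1 : K) ^ ((r + 1) * (p + 1)) • br P (br R Q) := by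
  rw [h.antisymm' hR hP hQ, h.antisymm r q R Q hR hQ, h.antisymm r p R P hR hP]
  rw [h.antisymm' hP hQ hR] at hJ
  have hJ' : br R (br P Q) = (-1 : K) ^ ((p + q) * (r + 1)) •
      ((-1 : K) ^ ((p + 1) * (q + 1)) • br Q (br P R) - br P (br Q R)) := by
    rw [hJ, sub_add_eq_sub_sub, sub_neg_eq_add]
    simp only [add_sub_cancel_left, smul_smul]
    rw [← pow_add, ← two_mul, pow_mul]; simp
  rw [hJ']
  simp only [map_neg, map_smul, smul_neg, smul_sub, smul_smul,
      pow_add, pow_mul, mul_one, one_mul, pow_one]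
  rcases neg_one_pow_eq_or K p with h1 | h1 <;> rcases neg_one_pow_eq_or K q with h2 | h2 <;>
    rcases neg_one_pow_eq_or K r with h3 | h3 <;>
      simp [h1, h2, h3] <;> abel

theorem IsSchouten.jacobi (h : IsSchouten br) {p q : ℕ} {P Q : Polyvec K A} (R : Polyvec K A)
    (hP : P ∈ polyvecDeg K A p) (hQ : Q ∈ polyvecDeg K A q) :
    br P (br Q R) = br (br P Q) R + (-1 : K) ^ ((p + 1) * (q + 1)) • br Q (br P R) := by
  have ad : ∀ (X : Derivation K A A) (a : A),
      br (algebraMap A _ a) (ι A X) = -(algebraMap A _ (X a)) := by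
    intro X a
    rw [h.antisymm 0 1 _ _ (alg_mem a) (ι_mem X), h.der_alg]; simp
  have gaa : ∀ (a b : A) r R, R ∈ polyvecDeg K A r →
      br (algebraMap A _ a) (br (algebraMap A _ b) R) =
      br (br (algebraMap A _ a) (algebraMap A _ b)) R +
      (-1 : K) ^ ((0 + 1) * (0 + 1)) • br (algebraMap A _ b) (br (algebraMap A _ a) R) := by
    intro a b r R hR
    refine h.jacobi_step (alg_mem a) (alg_mem b) (fun c => ?_) (fun Z => ?_) hR
    · simp [h.alg_alg]
    · simp [h.alg_alg, ad]
  have gXa : ∀ (X : Derivation K A A) (b : A) r R, R ∈ polyvecDeg K A r →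
      br (ι A X) (br (algebraMap A _ b) R) =
      br (br (ι A X) (algebraMap A _ b)) R +
      (-1 : K) ^ ((1 + 1) * (0 + 1)) • br (algebraMap A _ b) (br (ι A X) R) := by
    intro X b r R hR
    refine h.jacobi_step (ι_mem X) (alg_mem b) (fun c => ?_) (fun Z => ?_) hR
    · simp [h.alg_alg, h.der_alg]
    · simp [h.der_alg, ad, h.der_der, Derivation.commutator_apply]; try abel
  have gaX : ∀ (a : A) (Y : Derivation K A A) r R, R ∈ polyvecDeg K A r →
      br (algebraMap A _ a) (br (ι A Y) R) =
      br (br (algebraMap A _ a) (ι A Y)) R +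
      (-1 : K) ^ ((0 + 1) * (1 + 1)) • br (ι A Y) (br (algebraMap A _ a) R) := by
    intro a Y r R hR
    refine h.jacobi_step (alg_mem a) (ι_mem Y) (fun c => ?_) (fun Z => ?_) hR
    · simp [h.alg_alg, h.der_alg, ad]
    · simp [h.der_alg, ad, h.der_der, Derivation.commutator_apply]; try abel
  have e4 : (-1 : K) ^ ((1 + 1) * (1 + 1)) = 1 := by norm_num
  have gXX : ∀ (X Y : Derivation K A A) r R, R ∈ polyvecDeg K A r →
      br (ι A X) (br (ι A Y) R) = br (br (ι A X) (ι A Y)) R +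
      (-1 : K) ^ ((1 + 1) * (1 + 1)) • br (ι A Y) (br (ι A X) R) := by
    intro X Y r R hR
    refine h.jacobi_step (ι_mem X) (ι_mem Y) (fun c => ?_) (fun Z => ?_) hR
    · rw [e4]; simp [h.der_alg, h.der_der, Derivation.commutator_apply]
    · rw [e4]; simp [h.der_der]
  have g1 : ∀ (a : A) p P, P ∈ polyvecDeg K A p → ∀ r R, R ∈ polyvecDeg K A r →
      br (algebraMap A _ a) (br P R) = br (br (algebraMap A _ a) P) R +
      (-1 : K) ^ ((0 + 1) * (p + 1)) • br P (br (algebraMap A _ a) R) := by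
    intro a p P hP r R hR
    refine h.jacobi_step (alg_mem a) hP (fun c => ?_) (fun Z => ?_) hR
    · exact h.jacobi_rot hP (alg_mem c) (alg_mem a) (h.jacobi_rot (alg_mem c) (alg_mem a) hP
        (gaa c a p P hP))
    · exact h.jacobi_rot hP (ι_mem Z) (alg_mem a) (h.jacobi_rot (ι_mem Z) (alg_mem a) hP
        (gXa Z a p P hP))
  have g2 : ∀ (X : Derivation K A A) p P, P ∈ polyvecDeg K A p → ∀ r R, R ∈ polyvecDeg K A r →
      br (ι A X) (br P R) = br (br (ι A X) P) R +
      (-1 : K) ^ ((1 + 1) * (p + 1)) • br P (br (ι A X) R) := by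
    intro X p P hP r R hR
    refine h.jacobi_step (ι_mem X) hP (fun c => ?_) (fun Z => ?_) hR
    · exact h.jacobi_rot hP (alg_mem c) (ι_mem X) (h.jacobi_rot (alg_mem c) (ι_mem X) hP
        (gaX c X p P hP))
    · exact h.jacobi_rot hP (ι_mem Z) (ι_mem X) (h.jacobi_rot (ι_mem Z) (ι_mem X) hP
        (gXX Z X p P hP))
  induction R using polyvec_hom_span with
  | hadd x y h1 h2 => simp only [map_add, h1, h2, smul_add]; abel
  | h0 => simp
  | h n R hR =>
    refine h.jacobi_step hP hQ (fun a => ?_) (fun X => ?_) hR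
    · exact h.jacobi_rot hQ (alg_mem a) hP (h.jacobi_rot (alg_mem a) hP hQ (g1 a p P hP q Q hQ))
    · exact h.jacobi_rot hQ (ι_mem X) hP (h.jacobi_rot (ι_mem X) hP hQ (g2 X p P hP q Q hQ))

end Jacobi
end Schouten

section Tensor
open TensorAlgebra
variable {K V : Type*} [Field K] [AddCommGroup V] [Module K V]

/-- Recursion on words: `recW F n₀ 1 = n₀` and `recW F n₀ (x w) = F x (w, recW F n₀ w)`. -/
noncomputable def recW {N : Type*} [AddCommGroup N] [Module K N]
    (F : V →ₗ[K] (TensorAlgebra K V × N) →ₗ[K] N) (n₀ : N) : TensorAlgebra K V →ₗ[K] N :=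
  LinearMap.snd K _ _ ∘ₗ LinearMap.applyₗ ((1 : TensorAlgebra K V), n₀) ∘ₗ
    (TensorAlgebra.lift K (LinearMap.mk₂ K
      (fun (x : V) (z : TensorAlgebra K V × N) => (ι K x * z.1, F x z))
      (by intros; simp [add_mul]) (by intros; simp) (by intros; simp [mul_add]) (by intros; simp)
      : V →ₗ[K] Module.End K (TensorAlgebra K V × N))).toLinearMap

section
variable {N : Type*} [AddCommGroup N] [Module K N]
    (F : V →ₗ[K] (TensorAlgebra K V × N) →ₗ[K] N) (n₀ : N)

theorem recW_one : recW F n₀ 1 = n₀ := by simp [recW]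

theorem recW_cons (x : V) (w : TensorAlgebra K V) :
    recW F n₀ (ι K x * w) = F x (w, recW F n₀ w) := by
  have h : ∀ w : TensorAlgebra K V, ∀ z : TensorAlgebra K V × N, ((TensorAlgebra.lift K (LinearMap.mk₂ K
      (fun (x : V) (z : TensorAlgebra K V × N) => (ι K x * z.1, F x z))
      (by intros; simp [add_mul]) (by intros; simp) (by intros; simp [mul_add]) (by intros; simp)
      : V →ₗ[K] Module.End K (TensorAlgebra K V × N))) w z).1 = w * z.1 := by
    intro w
    induction w using TensorAlgebra.induction with
    | algebraMap r => intro z; simp [Algebra.smul_def]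
    | ι x => intro z; simp
    | mul a b ha hb => intro z; simp [ha, hb, mul_assoc]
    | add a b ha hb => intro z; simp [ha, hb, add_mul]
  simp only [recW, LinearMap.comp_apply, AlgHom.toLinearMap_apply, map_mul,
    TensorAlgebra.lift_ι_apply, LinearMap.applyₗ_apply_apply, Module.End.mul_apply,
    LinearMap.mk₂_apply, LinearMap.snd_apply]
  congr 1
  refine Prod.ext ?_ rfl
  rw [h]; simp

end

/-- `headMap h (x w) = h x w` and `headMap h 1 = 0`. -/
noncomputable def headMap :
    (V →ₗ[K] TensorAlgebra K V →ₗ[K] TensorAlgebra K V) →ₗ[K]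
      TensorAlgebra K V →ₗ[K] TensorAlgebra K V :=
  LinearMap.flip (recW (N := (V →ₗ[K] TensorAlgebra K V →ₗ[K] TensorAlgebra K V) →ₗ[K]
      TensorAlgebra K V)
    (LinearMap.mk₂ K (fun x z => LinearMap.applyₗ z.1 ∘ₗ LinearMap.applyₗ x)
      (by intros; ext; simp) (by intros; ext; simp) (by intros; ext; simp) (by intros; ext; simp))
    0)

@[simp] theorem headMap_one (h : V →ₗ[K] TensorAlgebra K V →ₗ[K] TensorAlgebra K V) :
    headMap h 1 = 0 := by simp [headMap, recW_one]

@[simp] theorem headMap_cons (h : V →ₗ[K] TensorAlgebra K V →ₗ[K] TensorAlgebra K V) (x : V)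
    (w : TensorAlgebra K V) : headMap h (ι K x * w) = h x w := by
  simp [headMap, recW_cons]

/-- `tailSum G w` is the sum of `u * G v` over all deconcatenations `w = u v`. -/
noncomputable def tailSum :
    (TensorAlgebra K V →ₗ[K] TensorAlgebra K V) →ₗ[K]
      TensorAlgebra K V →ₗ[K] TensorAlgebra K V :=
  LinearMap.flip (recW (N := (TensorAlgebra K V →ₗ[K] TensorAlgebra K V) →ₗ[K] TensorAlgebra K V)
    (LinearMap.mk₂ K (fun x z => LinearMap.mulLeft K (ι K x) ∘ₗ z.2 + LinearMap.applyₗ (ι K x * z.1))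
      (by intros; ext; simp [add_mul]; abel) (by intros; ext; simp)
      (by intros; ext; simp [mul_add]; abel) (by intros; ext; simp))
    (LinearMap.applyₗ 1))

@[simp] theorem tailSum_one (G : TensorAlgebra K V →ₗ[K] TensorAlgebra K V) :
    tailSum G 1 = G 1 := by simp [tailSum, recW_one]

@[simp] theorem tailSum_cons (G : TensorAlgebra K V →ₗ[K] TensorAlgebra K V) (x : V)
    (w : TensorAlgebra K V) :
    tailSum G (ι K x * w) = ι K x * tailSum G w + G (ι K x * w) := by
  simp [tailSum, recW_cons]

variable (s : V →ₗ[K] V)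

/-- The parity involution of the tensor algebra induced by a parity involution of the letters. -/
noncomputable def par : TensorAlgebra K V →ₐ[K] TensorAlgebra K V :=
  TensorAlgebra.lift K (ι K ∘ₗ s)

@[simp] theorem par_ι (x : V) : par s (ι K x) = ι K (s x) := by simp [par]

/-- The even part of a letter. -/
noncomputable def evPart : V →ₗ[K] V := (2⁻¹ : K) • (LinearMap.id + s)

/-- The odd part of a letter. -/
noncomputable def odPart : V →ₗ[K] V := (2⁻¹ : K) • (LinearMap.id - s)

/-- `passLetter s y G v = (-1)^(|y||v|) y * G v`. -/
noncomputable def passLetter : V →ₗ[K] (TensorAlgebra K V →ₗ[K] TensorAlgebra K V) →ₗ[K]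
    TensorAlgebra K V →ₗ[K] TensorAlgebra K V :=
  LinearMap.mk₂ K (fun y G => LinearMap.mulLeft K (ι K (evPart s y)) ∘ₗ G +
      LinearMap.mulLeft K (ι K (odPart s y)) ∘ₗ G ∘ₗ (par s).toLinearMap)
    (by intros; ext; simp [add_mul]; abel) (by intros; ext; simp)
    (by intros; ext; simp [mul_add]; abel) (by intros; ext; simp)

/-- The shuffle product with Koszul signs, in the form `w ⧢ (y b) = ∑ ± u y (v ⧢ b)`,
the sum running over all deconcatenations `w = u v`. -/
noncomputable def shuffle : TensorAlgebra K V →ₗ[K] TensorAlgebra K V →ₗ[K] TensorAlgebra K V :=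
  LinearMap.flip (LinearMap.applyₗ LinearMap.id ∘ₗ (TensorAlgebra.lift K
    (LinearMap.mk₂ K (fun y G => tailSum (passLetter s y G))
      (by intros; simp) (by intros; simp) (by intros; simp) (by intros; simp) :
      V →ₗ[K] Module.End K (TensorAlgebra K V →ₗ[K] TensorAlgebra K V))).toLinearMap)

@[simp] theorem shuffle_one (a : TensorAlgebra K V) : shuffle s a 1 = a := by simp [shuffle]

theorem shuffle_cons_right (a b : TensorAlgebra K V) (y : V) : shuffle s a (ι K y * b) =
    tailSum (passLetter s y ((shuffle s).flip b)) a := by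
  simp [shuffle]

variable (β : V →ₗ[K] V →ₗ[K] V)

/-- `contractLetter s β y G x v = (-1)^(|y||v|) β(x, y) * G v`. -/
noncomputable def contractLetter : V →ₗ[K] (TensorAlgebra K V →ₗ[K] TensorAlgebra K V) →ₗ[K]
    V →ₗ[K] TensorAlgebra K V →ₗ[K] TensorAlgebra K V :=
  LinearMap.mk₂ K (fun y G => LinearMap.mk₂ K
      (fun x v => ι K (β x (evPart s y)) * G v + ι K (β x (odPart s y)) * G (par s v))
      (by intros; simp [add_mul]; abel) (by intros; simp)
      (by intros; simp [mul_add]; abel) (by intros; simp))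
    (by intros; ext; simp [add_mul]; abel) (by intros; ext; simp)
    (by intros; ext; simp [mul_add]; abel) (by intros; ext; simp)

/-- The Lie bracket on words:
`{w, y b} = ∑ ± u y {v, b} + ∑ ± u β(x, y) (v ⧢ b)`, the first sum running over all
deconcatenations `w = u v` and the second one over all deconcatenations `w = u x v` with a
letter `x`; moreover `{w, 1} = 0`.
In other words, `{a, b}` is the sum of all signed shuffles of `a` and `b` in which a letter `x` of
`a` that immediately precedes a letter `y` of `b` is contracted with it to the letter `β(x, y)`. The
component of the bracket in the words of length one is `β`, and the deconcatenation `Δ` satisfies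
`Δ {a, b} = ∑ ± {a', b'} ⊗ (a'' ⧢ b'') + ∑ ± (a' ⧢ b') ⊗ {a'', b''}`. Hence, modulo shuffle
products, this is the bracket with corestriction `β` that is compatible with the Lie cobracket. -/
noncomputable def wordBracket :
    TensorAlgebra K V →ₗ[K] TensorAlgebra K V →ₗ[K] TensorAlgebra K V :=
  LinearMap.flip (recW (N := TensorAlgebra K V →ₗ[K] TensorAlgebra K V)
    (LinearMap.mk₂ K (fun y z => tailSum (passLetter s y z.2) +
        tailSum (headMap (contractLetter s β y ((shuffle s).flip z.1))))
      (by intros; simp; abel) (by intros; simp) (by intros; simp; abel) (by intros; simp))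
    0)

theorem wordBracket_cons_right (a b : TensorAlgebra K V) (y : V) :
    wordBracket s β a (ι K y * b) = tailSum (passLetter s y ((wordBracket s β).flip b)) a +
      tailSum (headMap (contractLetter s β y ((shuffle s).flip b))) a := by
  simp [wordBracket, recW_cons]

@[simp] theorem wordBracket_one (a : TensorAlgebra K V) : wordBracket s β a 1 = 0 := by
  simp [wordBracket, recW_one]

/-- The Harrison codifferential on words:
`b (x₁ ⋯ xₖ) = ∑ ± x₁ ⋯ μ(xᵢ, xᵢ₊₁) ⋯ xₖ`. -/
noncomputable def harr (μ : V →ₗ[K] V →ₗ[K] V) : TensorAlgebra K V →ₗ[K] TensorAlgebra K V :=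
  recW (LinearMap.mk₂ K (fun x z => headMap (LinearMap.mul K (TensorAlgebra K V) ∘ₗ ι K ∘ₗ μ x) z.1 +
      ι K (s x) * z.2)
    (by intros; simp [add_mul, LinearMap.comp_add]; abel)
    (by intros; simp [LinearMap.comp_smul])
    (by intros; simp [mul_add]; abel) (by intros; simp)) 0

variable (μ : V →ₗ[K] V →ₗ[K] V)

@[simp] theorem harr_one : harr s μ 1 = 0 := by simp [harr, recW_one]

theorem harr_cons (x : V) (w : TensorAlgebra K V) : harr s μ (ι K x * w) =
    headMap (LinearMap.mul K (TensorAlgebra K V) ∘ₗ ι K ∘ₗ μ x) w + ι K (s x) * harr s μ w := by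
  simp [harr, recW_cons]

end Tensor

section Tensor
open TensorAlgebra
variable {K V : Type*} [Field K] [AddCommGroup V] [Module K V]
variable (s : V →ₗ[K] V) (β μ : V →ₗ[K] V →ₗ[K] V)

theorem neg_one_pow_mul_two (n : ℕ) : (-1 : K) ^ (n * 2) = 1 := by
  rw [mul_comm, pow_mul]; simp

/-- Words in homogeneous letters, with their parity. -/
inductive IsWord : ℕ → TensorAlgebra K V → Prop
  | one : IsWord 0 1
  | cons {p m : ℕ} {x : V} {w : TensorAlgebra K V} (hx : s x = (-1 : K) ^ p • x)
      (hw : IsWord m w) : IsWord (p + m) (ι K x * w)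

variable {s}

theorem par_cons {p m : ℕ} {x : V} {w : TensorAlgebra K V} (hx : s x = (-1 : K) ^ p • x)
    (hw : par s w = (-1 : K) ^ m • w) : par s (ι K x * w) = (-1 : K) ^ (p + m) • (ι K x * w) := by
  rw [map_mul, par_ι, hx, hw, map_smul, smul_mul_smul_comm, pow_add]

theorem IsWord.par_eq {m : ℕ} {w : TensorAlgebra K V} (h : IsWord s m w) :
    par s w = (-1 : K) ^ m • w := by
  induction h with
  | one => simp
  | cons hx _ ih => exact par_cons hx ih

section
variable [CharZero K]

theorem evPart_eq {p : ℕ} {x : V} (hx : s x = (-1 : K) ^ p • x) :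
    evPart s x = if Even p then x else 0 := by
  simp only [evPart, LinearMap.smul_apply, LinearMap.add_apply, LinearMap.id_apply, hx]
  split_ifs with h
  · rw [h.neg_one_pow, one_smul, ← two_smul K x, smul_smul]; simp
  · rw [(Nat.not_even_iff_odd.1 h).neg_one_pow]; simp

theorem odPart_eq {p : ℕ} {x : V} (hx : s x = (-1 : K) ^ p • x) :
    odPart s x = if Even p then 0 else x := by
  simp only [odPart, LinearMap.smul_apply, LinearMap.sub_apply, LinearMap.id_apply, hx]
  split_ifs with h
  · rw [h.neg_one_pow, one_smul]; simp
  · rw [(Nat.not_even_iff_odd.1 h).neg_one_pow, neg_one_smul, sub_neg_eq_add, ← two_smul K x,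
        smul_smul]; simp

theorem passLetter_eq {q m : ℕ} {y : V} {v : TensorAlgebra K V} (hy : s y = (-1 : K) ^ q • y)
    (hv : par s v = (-1 : K) ^ m • v) (G : TensorAlgebra K V →ₗ[K] TensorAlgebra K V) :
    passLetter s y G v = (-1 : K) ^ (q * m) • (ι K y * G v) := by
  simp only [passLetter, LinearMap.mk₂_apply, LinearMap.add_apply, LinearMap.comp_apply,
    LinearMap.mulLeft_apply, AlgHom.toLinearMap_apply, evPart_eq hy, odPart_eq hy, hv, pow_mul]
  split_ifs with h
  · simp [h.neg_one_pow]
  · simp [(Nat.not_even_iff_odd.1 h).neg_one_pow]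

theorem contractLetter_eq {q m : ℕ} {y : V} {v : TensorAlgebra K V}
    (hy : s y = (-1 : K) ^ q • y) (hv : par s v = (-1 : K) ^ m • v)
    (G : TensorAlgebra K V →ₗ[K] TensorAlgebra K V) (x : V) :
    contractLetter s β y G x v = (-1 : K) ^ (q * m) • (ι K (β x y) * G v) := by
  simp only [contractLetter, LinearMap.mk₂_apply, evPart_eq hy, odPart_eq hy, hv, pow_mul]
  split_ifs with h
  · simp [h.neg_one_pow]
  · simp [(Nat.not_even_iff_odd.1 h).neg_one_pow]

theorem shuffle_cons {p q m : ℕ} {x y : V} {a : TensorAlgebra K V} (b : TensorAlgebra K V)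
    (hx : s x = (-1 : K) ^ p • x) (hy : s y = (-1 : K) ^ q • y)
    (ha : par s a = (-1 : K) ^ m • a) :
    shuffle s (ι K x * a) (ι K y * b) = ι K x * shuffle s a (ι K y * b) +
      (-1 : K) ^ (q * (p + m)) • (ι K y * shuffle s (ι K x * a) b) := by
  rw [shuffle_cons_right, shuffle_cons_right, tailSum_cons, passLetter_eq hy (par_cons hx ha)]
  rfl

theorem wordBracket_cons {p q m : ℕ} {x y : V} {a : TensorAlgebra K V} (b : TensorAlgebra K V)
    (hx : s x = (-1 : K) ^ p • x) (hy : s y = (-1 : K) ^ q • y)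
    (ha : par s a = (-1 : K) ^ m • a) :
    wordBracket s β (ι K x * a) (ι K y * b) = ι K x * wordBracket s β a (ι K y * b) +
      (-1 : K) ^ (q * (p + m)) • (ι K y * wordBracket s β (ι K x * a) b) +
      (-1 : K) ^ (q * m) • (ι K (β x y) * shuffle s a b) := by
  rw [wordBracket_cons_right, wordBracket_cons_right, tailSum_cons, tailSum_cons,
    passLetter_eq hy (par_cons hx ha), headMap_cons, contractLetter_eq β hy ha, mul_add (ι K x)]
  simp only [LinearMap.flip_apply]
  abel

theorem harr_cons' {p : ℕ} {x : V} (w : TensorAlgebra K V) (hx : s x = (-1 : K) ^ p • x) :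
    harr s μ (ι K x * w) =
    headMap (LinearMap.mul K (TensorAlgebra K V) ∘ₗ ι K ∘ₗ μ x) w +
      (-1 : K) ^ p • (ι K x * harr s μ w) := by
  rw [harr_cons, hx]; simp

/-- A subspace that contains all words in homogeneous letters is everything. -/
theorem word_span (hs : ∀ x, s (s x) = x) (C : TensorAlgebra K V → Prop)
    (hadd : ∀ x y, C x → C y → C (x + y)) (hsmul : ∀ (c : K) x, C x → C (c • x))
    (h : ∀ m w, IsWord s m w → C w) (w : TensorAlgebra K V) : C w := by
  let W : Submodule K (TensorAlgebra K V) := Submodule.span K {w | ∃ m, IsWord s m w}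
  have hW : ∀ w ∈ W, C w := by
    intro w hw
    induction hw using Submodule.span_induction with
    | mem x hx => obtain ⟨m, hm⟩ := hx; exact h m x hm
    | zero => simpa using hsmul 0 1 (h 0 1 IsWord.one)
    | add x y _ _ hx hy => exact hadd x y hx hy
    | smul c x _ hx => exact hsmul c x hx
  have hl : ∀ (x : V), ∀ w ∈ W, ι K x * w ∈ W := by
    intro x w hw
    have hx : x = evPart s x + odPart s x := by
      simp only [evPart, odPart, LinearMap.smul_apply, LinearMap.add_apply, LinearMap.sub_apply,
        LinearMap.id_apply, ← smul_add]
      rw [add_add_sub_cancel, ← two_smul K x, smul_smul]; simp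
    induction hw using Submodule.span_induction with
    | mem w hw =>
      obtain ⟨m, hm⟩ := hw
      rw [hx, map_add, add_mul]
      refine add_mem (Submodule.subset_span ⟨0 + m, .cons ?_ hm⟩)
        (Submodule.subset_span ⟨1 + m, .cons ?_ hm⟩)
      · simp [evPart, hs, add_comm]
      · simp [odPart, hs, ← smul_neg]
    | zero => rw [mul_zero]; exact zero_mem _
    | add w w' _ _ h1 h2 => rw [mul_add]; exact add_mem h1 h2
    | smul c w _ h1 => rw [mul_smul_comm]; exact Submodule.smul_mem _ _ h1
  have hall : ∀ a : TensorAlgebra K V, ∀ w ∈ W, a * w ∈ W := by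
    intro a
    induction a using TensorAlgebra.induction with
    | algebraMap r => intro w hw; rw [← Algebra.smul_def]; exact Submodule.smul_mem _ _ hw
    | ι x => exact hl x
    | mul a b ha hb => intro w hw; rw [mul_assoc]; exact ha _ (hb _ hw)
    | add a b ha hb => intro w hw; rw [add_mul]; exact add_mem (ha _ hw) (hb _ hw)
  have := hall w 1 (Submodule.subset_span ⟨0, .one⟩)
  rw [mul_one] at this
  exact hW w this

theorem one_shuffle (hs : ∀ x, s (s x) = x) (b : TensorAlgebra K V) : shuffle s 1 b = b := by
  induction b using word_span hs with
  | hadd x y h1 h2 => rw [map_add, h1, h2]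
  | hsmul c x h => rw [map_smul, h]
  | h m w hw =>
    induction hw with
    | one => simp
    | cons hx hw ih =>
      rw [shuffle_cons_right, tailSum_one, passLetter_eq hx (m := 0) (by simp)]
      simp [ih]

theorem one_wordBracket (hs : ∀ x, s (s x) = x) (b : TensorAlgebra K V) :
    wordBracket s β 1 b = 0 := by
  induction b using word_span hs with
  | hadd x y h1 h2 => rw [map_add, h1, h2, add_zero]
  | hsmul c x h => rw [map_smul, h, smul_zero]
  | h m w hw =>
    induction hw with
    | one => simp
    | cons hx hw ih =>
      rw [wordBracket_cons_right, tailSum_one, tailSum_one, passLetter_eq hx (m := 0) (by simp)]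
      simp [ih]

theorem shuffle_par (hs : ∀ x, s (s x) = x) {m n : ℕ} {a b : TensorAlgebra K V} (ha : IsWord s m a) (hb : IsWord s n b) :
    par s (shuffle s a b) = (-1 : K) ^ (m + n) • shuffle s a b := by
  induction ha generalizing n b with
  | one => rw [one_shuffle hs, hb.par_eq, zero_add]
  | @cons p m x a hx ha iha =>
    induction hb with
    | one => rw [shuffle_one, par_cons hx ha.par_eq, add_zero]
    | @cons q n y b hy hb ihb =>
      rw [shuffle_cons b hx hy ha.par_eq, map_add, map_smul, par_cons hx (iha (.cons hy hb)),
        par_cons hy ihb]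
      module

theorem shuffle_comm (hs : ∀ x, s (s x) = x) {m n : ℕ} {a b : TensorAlgebra K V} (ha : IsWord s m a) (hb : IsWord s n b) :
    shuffle s b a = (-1 : K) ^ (m * n) • shuffle s a b := by
  induction ha generalizing n b with
  | one => rw [one_shuffle hs, shuffle_one, zero_mul, pow_zero, one_smul]
  | @cons p m x a hx ha iha =>
    induction hb with
    | one => rw [one_shuffle hs, shuffle_one, mul_zero, pow_zero, one_smul]
    | @cons q n y b hy hb ihb =>
      rw [shuffle_cons b hx hy ha.par_eq, shuffle_cons a hy hx hb.par_eq, iha (.cons hy hb), ihb]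
      simp only [mul_smul_comm, smul_add, smul_smul]
      rw [add_comm]
      congr 2
      · ring
      · have : (-1 : K) ^ (q * (p + m) * 2) = 1 := by rw [mul_comm, pow_mul]; simp
        linear_combination (-(-1 : K) ^ ((p + m) * n)) * this

theorem shuffle_assoc (hs : ∀ x, s (s x) = x) {m n k : ℕ} {a b c : TensorAlgebra K V} (ha : IsWord s m a)
    (hb : IsWord s n b) (hc : IsWord s k c) :
    shuffle s (shuffle s a b) c = shuffle s a (shuffle s b c) := by
  induction ha generalizing n b k c with
  | one => rw [one_shuffle hs, one_shuffle hs]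
  | @cons p m x a hx ha iha =>
    induction hb generalizing k c with
    | one => rw [shuffle_one, one_shuffle hs]
    | @cons q n y b hy hb ihb =>
      induction hc with
      | one => rw [shuffle_one, shuffle_one]
      | @cons r k z c hz hc ihc =>
        have i1 := iha (.cons hy hb) (.cons hz hc)
        have i2 := ihb (.cons hz hc)
        rw [shuffle_cons b hx hy ha.par_eq] at ihc ⊢
        rw [map_add, map_smul, LinearMap.add_apply, LinearMap.smul_apply] at ihc ⊢
        rw [shuffle_cons c hx hz (shuffle_par hs ha (.cons hy hb)),
          shuffle_cons c hy hz (shuffle_par hs (.cons hx ha) hb), i1, i2,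
          shuffle_cons c hy hz hb.par_eq]
        have e := eq_sub_of_add_eq ihc
        rw [e]
        simp only [map_add, map_smul]
        rw [shuffle_cons _ hx hy ha.par_eq, shuffle_cons _ hx hz ha.par_eq]
        simp only [mul_add, mul_sub, mul_smul_comm]
        module

theorem wordBracket_par (hs : ∀ x, s (s x) = x) (hβ : ∀ x y, s (β x y) = β (s x) (s y))
    {m n : ℕ} {a b : TensorAlgebra K V} (ha : IsWord s m a) (hb : IsWord s n b) :
    par s (wordBracket s β a b) = (-1 : K) ^ (m + n) • wordBracket s β a b := by
  induction ha generalizing n b with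
  | one => rw [one_wordBracket β hs, map_zero, smul_zero]
  | @cons p m x a hx ha iha =>
    induction hb with
    | one => rw [wordBracket_one, map_zero, smul_zero]
    | @cons q n y b hy hb ihb =>
      have h : s (β x y) = (-1 : K) ^ (p + q) • β x y := by
        rw [hβ, hx, hy]; simp [smul_smul, pow_add, mul_comm]
      rw [wordBracket_cons β b hx hy ha.par_eq, map_add, map_add, map_smul, map_smul,
        par_cons hx (iha (.cons hy hb)), par_cons hy ihb, par_cons h (shuffle_par hs ha hb)]
      module

theorem wordBracket_antisymm (hs : ∀ x, s (s x) = x)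
    (hβa : ∀ p q x y, s x = (-1 : K) ^ p • x → s y = (-1 : K) ^ q • y →
      β y x = -((-1 : K) ^ (p * q) • β x y))
    {m n : ℕ} {a b : TensorAlgebra K V} (ha : IsWord s m a) (hb : IsWord s n b) :
    wordBracket s β b a = -((-1 : K) ^ (m * n) • wordBracket s β a b) := by
  induction ha generalizing n b with
  | one => rw [one_wordBracket β hs, wordBracket_one, smul_zero, neg_zero]
  | @cons p m x a hx ha iha =>
    induction hb with
    | one => rw [one_wordBracket β hs, wordBracket_one, smul_zero, neg_zero]
    | @cons q n y b hy hb ihb =>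
      rw [wordBracket_cons β b hx hy ha.par_eq, wordBracket_cons β a hy hx hb.par_eq,
        iha (.cons hy hb), ihb, shuffle_comm hs ha hb, hβa p q x y hx hy]
      simp only [map_neg, map_smul, mul_neg, neg_mul, smul_mul_assoc, mul_smul_comm]
      match_scalars <;> ring_nf <;> simp only [neg_one_pow_mul_two, mul_one]

theorem wordBracket_leibniz (hs : ∀ x, s (s x) = x) (hβ : ∀ x y, s (β x y) = β (s x) (s y))
    {m n k : ℕ} {a b c : TensorAlgebra K V} (ha : IsWord s m a)
    (hb : IsWord s n b) (hc : IsWord s k c) :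
    wordBracket s β (shuffle s a b) c = shuffle s a (wordBracket s β b c) +
      (-1 : K) ^ (n * k) • shuffle s (wordBracket s β a c) b := by
  induction ha generalizing n b k c with
  | one => simp [one_shuffle hs, one_wordBracket β hs]
  | @cons p m x a hx ha iha =>
    induction hb generalizing k c with
    | one => simp [one_wordBracket β hs]
    | @cons q n y b hy hb ihb =>
      induction hc with
      | one => simp
      | @cons r k z c hz hc ihc =>
        have hyz : s (β y z) = (-1 : K) ^ (q + r) • β y z := by
          rw [hβ, hy, hz]; simp [smul_smul, pow_add, mul_comm]
        have hxz : s (β x z) = (-1 : K) ^ (p + r) • β x z := by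
          rw [hβ, hx, hz]; simp [smul_smul, pow_add, mul_comm]
        have i1 := iha (.cons hy hb) (.cons hz hc)
        have i2 := ihb (.cons hz hc)
        have as1 : shuffle s (shuffle s a (ι K y * b)) c =
            (-1 : K) ^ (k * (q + n)) • shuffle s (shuffle s a c) (ι K y * b) := by
          rw [shuffle_assoc hs ha (.cons hy hb) hc, shuffle_comm hs hc (.cons hy hb), map_smul,
            shuffle_assoc hs ha hc (.cons hy hb)]
        have as2 := shuffle_assoc hs (.cons hx ha) hb hc
        have W1 := shuffle_par hs ha (.cons hy hb)
        have W2 := shuffle_par hs (.cons hx ha) hb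
        rw [shuffle_cons b hx hy ha.par_eq] at ihc ⊢
        rw [map_add, map_smul, LinearMap.add_apply, LinearMap.smul_apply] at ihc ⊢
        rw [wordBracket_cons β c hx hz W1, wordBracket_cons β c hy hz W2, i1, i2, as1, as2,
          eq_sub_of_add_eq ihc, wordBracket_cons β c hy hz hb.par_eq,
          wordBracket_cons β c hx hz ha.par_eq]
        simp only [map_add, map_smul, LinearMap.add_apply, LinearMap.smul_apply]
        rw [shuffle_cons _ hx hy ha.par_eq, shuffle_cons _ hx hz ha.par_eq,
          shuffle_cons _ hx hyz ha.par_eq,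
          shuffle_cons _ hx hy (wordBracket_par β hs hβ ha (.cons hz hc)),
          shuffle_cons _ hz hy (wordBracket_par β hs hβ (.cons hx ha) hc),
          shuffle_cons _ hxz hy (shuffle_par hs ha hc)]
        simp only [mul_add, mul_sub, mul_smul_comm]
        match_scalars <;> ring_nf <;> simp only [neg_one_pow_mul_two, mul_one]

theorem headMul_shuffle (hs : ∀ x, s (s x) = x) (hμ : ∀ x y, s (μ x y) = -μ (s x) (s y))
    {p q m : ℕ} {x y : V} {a : TensorAlgebra K V} (b : TensorAlgebra K V)
    (hx : s x = (-1 : K) ^ p • x) (hy : s y = (-1 : K) ^ q • y) (ha : IsWord s m a) :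
    headMap (LinearMap.mul K (TensorAlgebra K V) ∘ₗ ι K ∘ₗ μ x) (shuffle s a (ι K y * b)) =
      shuffle s (headMap (LinearMap.mul K (TensorAlgebra K V) ∘ₗ ι K ∘ₗ μ x) a) (ι K y * b) -
      (-1 : K) ^ (q * (p + m + 1)) • (ι K y *
        shuffle s (headMap (LinearMap.mul K (TensorAlgebra K V) ∘ₗ ι K ∘ₗ μ x) a) b) +
      (-1 : K) ^ (q * m) • (ι K (μ x y) * shuffle s a b) := by
  cases ha with
  | one => simp [one_shuffle hs]
  | @cons r m z a hz ha =>
    have hxz : s (μ x z) = (-1 : K) ^ (p + r + 1) • μ x z := by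
      rw [hμ, hx, hz]; simp [smul_smul, pow_add, mul_comm]
    rw [shuffle_cons b hz hy ha.par_eq]
    simp only [map_add, map_smul, headMap_cons, LinearMap.comp_apply, LinearMap.mul_apply']
    rw [shuffle_cons b hxz hy ha.par_eq]
    module

theorem headMul_shuffle' (hμ : ∀ x y, s (μ x y) = -μ (s x) (s y))
    {p q m n : ℕ} {x y : V} {a b : TensorAlgebra K V}
    (hx : s x = (-1 : K) ^ p • x) (hy : s y = (-1 : K) ^ q • y) (ha : IsWord s m a)
    (hb : IsWord s n b) :
    (-1 : K) ^ ((q + 1) * (p + m)) •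
      headMap (LinearMap.mul K (TensorAlgebra K V) ∘ₗ ι K ∘ₗ μ y) (shuffle s (ι K x * a) b) =
      (-1 : K) ^ ((q + 1) * (p + m)) • (ι K (μ y x) * shuffle s a b) +
      shuffle s (ι K x * a) (headMap (LinearMap.mul K (TensorAlgebra K V) ∘ₗ ι K ∘ₗ μ y) b) -
      ι K x * shuffle s a (headMap (LinearMap.mul K (TensorAlgebra K V) ∘ₗ ι K ∘ₗ μ y) b) := by
  cases hb with
  | one => simp
  | @cons r n z b hz hb =>
    have hyz : s (μ y z) = (-1 : K) ^ (q + r + 1) • μ y z := by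
      rw [hμ, hy, hz]; simp [smul_smul, pow_add, mul_comm]
    rw [shuffle_cons b hx hz ha.par_eq]
    simp only [map_add, map_smul, headMap_cons, LinearMap.comp_apply, LinearMap.mul_apply']
    rw [shuffle_cons b hx hyz ha.par_eq]
    module

theorem headMul_par (hμ : ∀ x y, s (μ x y) = -μ (s x) (s y)) {p m : ℕ} {x : V}
    {a : TensorAlgebra K V} (hx : s x = (-1 : K) ^ p • x) (ha : IsWord s m a) :
    par s (headMap (LinearMap.mul K (TensorAlgebra K V) ∘ₗ ι K ∘ₗ μ x) a) =
      (-1 : K) ^ (p + m + 1) • headMap (LinearMap.mul K (TensorAlgebra K V) ∘ₗ ι K ∘ₗ μ x) a := by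
  cases ha with
  | one => simp
  | @cons r m z a hz ha =>
    have hxz : s (μ x z) = (-1 : K) ^ (p + r + 1) • μ x z := by
      rw [hμ, hx, hz]; simp [smul_smul, pow_add, mul_comm]
    simp only [headMap_cons, LinearMap.comp_apply, LinearMap.mul_apply']
    rw [par_cons hxz ha.par_eq]
    module

theorem harr_par (hμ : ∀ x y, s (μ x y) = -μ (s x) (s y)) {m : ℕ}
    {a : TensorAlgebra K V} (ha : IsWord s m a) :
    par s (harr s μ a) = (-1 : K) ^ (m + 1) • harr s μ a := by
  induction ha with
  | one => simp
  | @cons p m x a hx ha ih =>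
    rw [harr_cons' μ a hx, map_add, map_smul, par_cons hx ih, headMul_par μ hμ hx ha]
    module

theorem harr_shuffle (hs : ∀ x, s (s x) = x) (hμ : ∀ x y, s (μ x y) = -μ (s x) (s y))
    (hμc : ∀ p q x y, s x = (-1 : K) ^ p • x → s y = (-1 : K) ^ q • y →
      μ x y = -((-1 : K) ^ (p * q) • μ y x))
    {m n : ℕ} {a b : TensorAlgebra K V} (ha : IsWord s m a) (hb : IsWord s n b) :
    harr s μ (shuffle s a b) = shuffle s (harr s μ a) b +
      (-1 : K) ^ m • shuffle s a (harr s μ b) := by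
  induction ha generalizing n b with
  | one => simp [one_shuffle hs]
  | @cons p m x a hx ha iha =>
    induction hb with
    | one => simp
    | @cons q n y b hy hb ihb =>
      have A := headMul_shuffle μ hs hμ b hx hy ha
      have B := headMul_shuffle' μ hμ hx hy ha hb
      have B' : (-1 : K) ^ (q * (p + m)) •
          headMap (LinearMap.mul K (TensorAlgebra K V) ∘ₗ ι K ∘ₗ μ y) (shuffle s (ι K x * a) b) =
          (-1 : K) ^ (p + m) • ((-1 : K) ^ ((q + 1) * (p + m)) •
          headMap (LinearMap.mul K (TensorAlgebra K V) ∘ₗ ι K ∘ₗ μ y) (shuffle s (ι K x * a) b)) := by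
        rw [smul_smul]; congr 1
        have h1 : (-1 : K) ^ ((p + m) * 2) = 1 := by rw [mul_comm, pow_mul]; simp
        linear_combination (-(-1 : K) ^ (q * (p + m))) * h1
      have i1 := iha (.cons hy hb)
      rw [shuffle_cons b hx hy ha.par_eq, map_add, map_smul, harr_cons' μ _ hx, harr_cons' μ _ hy,
        i1, ihb, smul_add, B', B, A, harr_cons' μ _ hx, harr_cons' μ _ hy, hμc p q x y hx hy]
      simp only [map_add, map_smul, LinearMap.add_apply, LinearMap.smul_apply]
      rw [shuffle_cons _ hx hy (harr_par μ hμ ha), shuffle_cons _ hx hy ha.par_eq]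
      simp only [mul_add, mul_smul_comm, map_neg, map_smul, neg_mul, smul_mul_assoc]
      match_scalars <;> ring_nf <;> (try simp only [neg_one_pow_mul_two, mul_one]) <;> ring

end
end Tensor

section Tensor
open TensorAlgebra
variable {K V : Type*} [Field K] [AddCommGroup V] [Module K V]
variable (s : V →ₗ[K] V) (β μ : V →ₗ[K] V →ₗ[K] V)

/-- The span of the empty word and of all shuffle products of two nonempty words. -/
def shuffleSpan : Submodule K (TensorAlgebra K V) :=
  Submodule.span K ({1} ∪ {c | ∃ x y a b, c = shuffle s (ι K x * a) (ι K y * b)})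

/-- The underlying space of the cofree Lie coalgebra cogenerated by `V`: nonempty words modulo
shuffle products of nonempty words. (The empty word is divided out together with the shuffle
products.) The grading of `V` enters through the parity involution `s`, which gives the Koszul signs
of the shuffle product. -/
abbrev CofreeLie := TensorAlgebra K V ⧸ shuffleSpan s

/-- The span of the nonempty words. -/
def posWord : Submodule K (TensorAlgebra K V) :=
  Submodule.span K {c | ∃ x a, c = ι K x * a}

variable {s}

theorem ι_mul_mem_posWord (x : V) (a : TensorAlgebra K V) : ι K x * a ∈ posWord (K := K) :=
  Submodule.subset_span ⟨x, a, rfl⟩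

theorem shuffle_mem {a b : TensorAlgebra K V} (ha : a ∈ posWord (K := K)) (hb : b ∈ posWord (K := K)) :
    shuffle s a b ∈ shuffleSpan s := by
  induction ha, hb using Submodule.span_induction₂ with
  | mem_mem x y hx hy =>
    obtain ⟨x, a, rfl⟩ := hx
    obtain ⟨y, b, rfl⟩ := hy
    exact Submodule.subset_span (Or.inr ⟨x, y, a, b, rfl⟩)
  | zero_left y hy => simp
  | zero_right x hx => simp
  | add_left x y z hx hy hz h1 h2 => rw [map_add]; exact add_mem h1 h2
  | add_right x y z hx hy hz h1 h2 => rw [map_add]; exact add_mem h1 h2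
  | smul_left r x y hx hy h => rw [map_smul]; exact Submodule.smul_mem _ _ h
  | smul_right r x y hx hy h => rw [map_smul]; exact Submodule.smul_mem _ _ h

variable [CharZero K]

theorem hom_span (hs : ∀ x, s (s x) = x) (C : V → Prop)
    (hadd : ∀ x y, C x → C y → C (x + y)) (h : ∀ p x, s x = (-1 : K) ^ p • x → C x) (x : V) :
    C x := by
  have hx : x = evPart s x + odPart s x := by
    simp only [evPart, odPart, LinearMap.smul_apply, LinearMap.add_apply, LinearMap.sub_apply,
      LinearMap.id_apply, ← smul_add]
    rw [add_add_sub_cancel, ← two_smul K x, smul_smul]; simp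
  rw [hx]
  refine hadd _ _ (h 0 _ ?_) (h 1 _ ?_)
  · simp [evPart, hs, add_comm]
  · simp [odPart, hs, ← smul_neg]

theorem cons_span (hs : ∀ x, s (s x) = x) (C : TensorAlgebra K V → Prop)
    (hadd : ∀ x y, C x → C y → C (x + y)) (hsmul : ∀ (c : K) x, C x → C (c • x))
    (h : ∀ p m x w, s x = (-1 : K) ^ p • x → IsWord s m w → C (ι K x * w)) (x : V)
    (w : TensorAlgebra K V) : C (ι K x * w) := by
  induction w using word_span hs with
  | hadd a b h1 h2 => rw [mul_add]; exact hadd _ _ h1 h2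
  | hsmul c a h => rw [mul_smul_comm]; exact hsmul _ _ h
  | h m w hw =>
    induction x using hom_span hs with
    | hadd x y h1 h2 => rw [map_add, add_mul]; exact hadd _ _ h1 h2
    | h p x hx => exact h p m x w hx hw

theorem shuffleSpan_induction_aux (hs : ∀ x, s (s x) = x) (C : TensorAlgebra K V → Prop)
    (hadd : ∀ x y, C x → C y → C (x + y)) (hsmul : ∀ (c : K) x, C x → C (c • x)) (one : C 1)
    (h : ∀ p m q n x a y b, s x = (-1 : K) ^ p • x → IsWord s m a → s y = (-1 : K) ^ q • y →
      IsWord s n b → C (shuffle s (ι K x * a) (ι K y * b)))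
    {w : TensorAlgebra K V} (hw : w ∈ shuffleSpan s) : C w := by
  induction hw using Submodule.span_induction with
  | mem w hw =>
    rcases hw with rfl | ⟨x, y, a, b, rfl⟩
    · exact one
    · refine cons_span hs (fun u => C (shuffle s u (ι K y * b)))
        (fun u v h1 h2 => by rw [map_add]; exact hadd _ _ h1 h2)
        (fun c u h => by rw [map_smul]; exact hsmul _ _ h) (fun p m x a hx ha => ?_) x a
      exact cons_span hs (fun u => C (shuffle s (ι K x * a) u))
        (fun u v h1 h2 => by rw [map_add]; exact hadd _ _ h1 h2)
        (fun c u h => by rw [map_smul]; exact hsmul _ _ h)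
        (fun q n y b hy hb => h p m q n x a y b hx ha hy hb) y b
  | zero => simpa using hsmul 0 1 one
  | add x y _ _ hx hy => exact hadd x y hx hy
  | smul c x _ hx => exact hsmul c x hx

theorem shuffleSpan_induction (hs : ∀ x, s (s x) = x)
    {C : ∀ w : TensorAlgebra K V, w ∈ shuffleSpan s → Prop}
    (hadd : ∀ x y hx hy, C x hx → C y hy → C (x + y) (add_mem hx hy))
    (hsmul : ∀ (c : K) x hx, C x hx → C (c • x) (Submodule.smul_mem _ c hx))
    (one : ∀ h1, C 1 h1)
    (h : ∀ p m q n x a y b hw, s x = (-1 : K) ^ p • x → IsWord s m a → s y = (-1 : K) ^ q • y →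
      IsWord s n b → C (shuffle s (ι K x * a) (ι K y * b)) hw)
    {w : TensorAlgebra K V} (hw : w ∈ shuffleSpan s) : C w hw := by
  obtain ⟨h', hC⟩ := shuffleSpan_induction_aux hs (fun w => ∃ hw, C w hw)
    (fun x y ⟨hx, h1⟩ ⟨hy, h2⟩ => ⟨_, hadd x y hx hy h1 h2⟩)
    (fun c x ⟨hx, h1⟩ => ⟨_, hsmul c x hx h1⟩)
    ⟨Submodule.subset_span (Or.inl rfl), one _⟩
    (fun p m q n x a y b hx ha hy hb => ⟨shuffle_mem (ι_mul_mem_posWord _ _)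
      (ι_mul_mem_posWord _ _), h p m q n x a y b _ hx ha hy hb⟩) hw
  exact hC

section

theorem par_par (hs : ∀ x, s (s x) = x) (w : TensorAlgebra K V) : par s (par s w) = w := by
  induction w using TensorAlgebra.induction with
  | algebraMap r => simp
  | ι x => simp [hs]
  | mul a b ha hb => rw [map_mul, map_mul, ha, hb]
  | add a b ha hb => rw [map_add, map_add, ha, hb]

theorem par_mem (hs : ∀ x, s (s x) = x) {w : TensorAlgebra K V} (hw : w ∈ shuffleSpan s) : par s w ∈ shuffleSpan s := by
  induction hw using shuffleSpan_induction hs with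
  | hadd x y _ _ h1 h2 => rw [map_add]; exact add_mem h1 h2
  | hsmul c x _ h => rw [map_smul]; exact Submodule.smul_mem _ _ h
  | one h1 => rw [map_one]; exact Submodule.subset_span (Or.inl rfl)
  | h p m q n x a y b _ hx ha hy hb =>
    rw [shuffle_par hs (.cons hx ha) (.cons hy hb)]
    exact Submodule.smul_mem _ _ (shuffle_mem (ι_mul_mem_posWord _ _) (ι_mul_mem_posWord _ _))

theorem wordBracket_pos {p m n : ℕ} {x : V} {a b : TensorAlgebra K V}
    (hx : s x = (-1 : K) ^ p • x) (ha : IsWord s m a) (hb : IsWord s n b) :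
    wordBracket s β (ι K x * a) b ∈ posWord (K := K) := by
  cases hb with
  | one => rw [wordBracket_one]; exact zero_mem _
  | cons hy hb =>
    rw [wordBracket_cons β _ hx hy ha.par_eq]
    exact add_mem (add_mem (ι_mul_mem_posWord _ _) (Submodule.smul_mem _ _ (ι_mul_mem_posWord _ _)))
      (Submodule.smul_mem _ _ (ι_mul_mem_posWord _ _))

theorem wordBracket_mem_left (hs : ∀ x, s (s x) = x) (hβ : ∀ x y, s (β x y) = β (s x) (s y))
    {w : TensorAlgebra K V} (hw : w ∈ shuffleSpan s) (c : TensorAlgebra K V) :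
    wordBracket s β w c ∈ shuffleSpan s := by
  induction c using word_span hs with
  | hadd x y h1 h2 => rw [map_add]; exact add_mem h1 h2
  | hsmul c x h => rw [map_smul]; exact Submodule.smul_mem _ _ h
  | h k c hc =>
  induction hw using shuffleSpan_induction hs with
  | hadd x y _ _ h1 h2 => rw [map_add]; exact add_mem h1 h2
  | hsmul c x _ h => rw [map_smul]; exact Submodule.smul_mem _ _ h
  | one h1 => rw [one_wordBracket β hs]; exact zero_mem _
  | h p m q n x a y b _ hx ha hy hb =>
    rw [wordBracket_leibniz β hs hβ (.cons hx ha) (.cons hy hb) hc]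
    exact add_mem (shuffle_mem (ι_mul_mem_posWord _ _) (wordBracket_pos β hy hb hc))
      (Submodule.smul_mem _ _ (shuffle_mem (wordBracket_pos β hx ha hc) (ι_mul_mem_posWord _ _)))

theorem wordBracket_antisymm' (hs : ∀ x, s (s x) = x)
    (hβa : ∀ p q x y, s x = (-1 : K) ^ p • x → s y = (-1 : K) ^ q • y →
      β y x = -((-1 : K) ^ (p * q) • β x y))
    {p q : ℕ} {a b : TensorAlgebra K V} (ha : par s a = (-1 : K) ^ p • a)
    (hb : par s b = (-1 : K) ^ q • b) :
    wordBracket s β b a = -((-1 : K) ^ (p * q) • wordBracket s β a b) := by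
  have key : ∀ n w, IsWord s n w → ∀ a, wordBracket s β w a =
      -(wordBracket s β ((2⁻¹ : K) • (a + par s a)) w) -
        (-1 : K) ^ n • wordBracket s β ((2⁻¹ : K) • (a - par s a)) w := by
    intro n w hw a
    induction a using word_span hs with
    | hadd x y h1 h2 =>
      rw [map_add, h1, h2]
      simp only [map_add, map_sub, map_smul, LinearMap.add_apply, LinearMap.smul_apply,
        LinearMap.sub_apply]
      module
    | hsmul c x h =>
      rw [map_smul, h]
      simp only [map_add, map_sub, map_smul, LinearMap.add_apply, LinearMap.smul_apply,
        LinearMap.sub_apply]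
      module
    | h m a ha =>
      rw [wordBracket_antisymm β hs hβa ha hw, ha.par_eq]
      simp only [map_add, map_sub, map_smul, LinearMap.add_apply, LinearMap.smul_apply,
        LinearMap.sub_apply, pow_mul]
      rcases neg_one_pow_eq_or K m with h1 | h1 <;> rw [h1] <;> match_scalars <;> ring
  have key2 : ∀ b, wordBracket s β b a = -((2⁻¹ : K) • (wordBracket s β a (b + par s b)
      + (-1 : K) ^ p • wordBracket s β a (b - par s b))) := by
    intro b
    induction b using word_span hs with
    | hadd x y h1 h2 =>
      rw [map_add, LinearMap.add_apply, h1, h2]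
      simp only [map_add, map_sub]
      module
    | hsmul c x h =>
      rw [map_smul, LinearMap.smul_apply, h]
      simp only [map_add, map_sub, map_smul]
      module
    | h m b hb =>
      rw [key m b hb a, hb.par_eq, ha]
      simp only [map_add, map_sub, map_smul, LinearMap.add_apply, LinearMap.smul_apply,
        LinearMap.sub_apply]
      rcases neg_one_pow_eq_or K m with h1 | h1 <;> rcases neg_one_pow_eq_or K p with h2 | h2 <;>
        rw [h1, h2] <;> match_scalars <;> ring
  rw [key2, hb]
  simp only [map_add, map_sub, map_smul, pow_mul]
  rcases neg_one_pow_eq_or K p with h1 | h1 <;> rcases neg_one_pow_eq_or K q with h2 | h2 <;>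
    rw [h1, h2] <;> match_scalars <;> norm_num

theorem wordBracket_mem_right (hs : ∀ x, s (s x) = x) (hβ : ∀ x y, s (β x y) = β (s x) (s y))
    (hβa : ∀ p q x y, s x = (-1 : K) ^ p • x → s y = (-1 : K) ^ q • y →
      β y x = -((-1 : K) ^ (p * q) • β x y))
    {w : TensorAlgebra K V} (hw : w ∈ shuffleSpan s) (c : TensorAlgebra K V) :
    wordBracket s β c w ∈ shuffleSpan s := by
  induction c using word_span hs with
  | hadd x y h1 h2 => rw [map_add]; exact add_mem h1 h2
  | hsmul c x h => rw [map_smul]; exact Submodule.smul_mem _ _ h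
  | h k c hc =>
  induction hw using shuffleSpan_induction hs with
  | hadd x y _ _ h1 h2 => rw [map_add]; exact add_mem h1 h2
  | hsmul c x _ h => rw [map_smul]; exact Submodule.smul_mem _ _ h
  | one h1 => rw [wordBracket_one]; exact zero_mem _
  | h p m q n x a y b _ hx ha hy hb =>
    rw [wordBracket_antisymm' β hs hβa (shuffle_par hs (.cons hx ha) (.cons hy hb)) hc.par_eq]
    exact neg_mem (Submodule.smul_mem _ _ (wordBracket_mem_left β hs hβ
      (shuffle_mem (ι_mul_mem_posWord _ _) (ι_mul_mem_posWord _ _)) c))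

theorem harr_mem (hs : ∀ x, s (s x) = x) (hμ : ∀ x y, s (μ x y) = -μ (s x) (s y))
    (hμc : ∀ p q x y, s x = (-1 : K) ^ p • x → s y = (-1 : K) ^ q • y →
      μ x y = -((-1 : K) ^ (p * q) • μ y x))
    {w : TensorAlgebra K V} (hw : w ∈ shuffleSpan s) : harr s μ w ∈ shuffleSpan s := by
  have pos : ∀ p m x a, s x = (-1 : K) ^ p • x → IsWord s m a →
      harr s μ (ι K x * a) ∈ posWord (K := K) := by
    intro p m x a hx ha
    rw [harr_cons]
    refine add_mem ?_ (ι_mul_mem_posWord _ _)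
    cases ha with
    | one => rw [headMap_one]; exact zero_mem _
    | cons hy hb => rw [headMap_cons]; exact ι_mul_mem_posWord _ _
  induction hw using shuffleSpan_induction hs with
  | hadd x y _ _ h1 h2 => rw [map_add]; exact add_mem h1 h2
  | hsmul c x _ h => rw [map_smul]; exact Submodule.smul_mem _ _ h
  | one h1 => rw [harr_one]; exact zero_mem _
  | h p m q n x a y b _ hx ha hy hb =>
    rw [harr_shuffle μ hs hμ hμc (.cons hx ha) (.cons hy hb)]
    exact add_mem (shuffle_mem (pos _ _ _ _ hx ha) (ι_mul_mem_posWord _ _))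
      (Submodule.smul_mem _ _ (shuffle_mem (ι_mul_mem_posWord _ _) (pos _ _ _ _ hy hb)))

theorem harr_par' (hs : ∀ x, s (s x) = x) (hμ : ∀ x y, s (μ x y) = -μ (s x) (s y)) (w : TensorAlgebra K V) :
    par s (harr s μ w) = - harr s μ (par s w) := by
  induction w using word_span hs with
  | hadd x y h1 h2 => simp only [map_add, h1, h2]; abel
  | hsmul c x h => simp only [map_smul, h, smul_neg]
  | h m w hw => rw [harr_par μ hμ hw, hw.par_eq, map_smul, pow_succ]; simp

theorem wordBracket_par' (hs : ∀ x, s (s x) = x) (hβ : ∀ x y, s (β x y) = β (s x) (s y)) (a b : TensorAlgebra K V) :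
    par s (wordBracket s β a b) = wordBracket s β (par s a) (par s b) := by
  induction a using word_span hs with
  | hadd x y h1 h2 => simp only [map_add, LinearMap.add_apply, h1, h2]
  | hsmul c x h => simp only [map_smul, LinearMap.smul_apply, h]
  | h m a ha =>
    induction b using word_span hs with
    | hadd x y h1 h2 => simp only [map_add, h1, h2]
    | hsmul c x h => simp only [map_smul, h]
    | h n b hb =>
      rw [wordBracket_par β hs hβ ha hb, ha.par_eq, hb.par_eq, pow_add]
      simp [smul_smul, mul_comm]

end
end Tensor

section Sym
variable {K L : Type*} [Field K] [AddCommGroup L] [Module K L] (σ : L →ₗ[K] L)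

/-- Graded commutativity of the desuspension of `L`: an element `x` of parity `p` in `L` has
parity `p + 1` in the desuspension. -/
inductive SymRel : TensorAlgebra K L → TensorAlgebra K L → Prop
  | swap (p q : ℕ) (x y : L) (hx : σ x = (-1 : K) ^ p • x) (hy : σ y = (-1 : K) ^ q • y) :
      SymRel (TensorAlgebra.ι K x * TensorAlgebra.ι K y)
        ((-1 : K) ^ ((p + 1) * (q + 1)) • (TensorAlgebra.ι K y * TensorAlgebra.ι K x))

/-- The graded symmetric algebra of the desuspension of `L`. -/
abbrev SuspSym := RingQuot (SymRel σ)

/-- The inclusion of the generators. -/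
noncomputable def symι : L →ₗ[K] SuspSym σ :=
  (RingQuot.mkAlgHom K (SymRel σ)).toLinearMap ∘ₗ TensorAlgebra.ι K

variable {σ}

theorem symι_comm {p q : ℕ} {x y : L} (hx : σ x = (-1 : K) ^ p • x) (hy : σ y = (-1 : K) ^ q • y) :
    symι σ x * symι σ y = (-1 : K) ^ ((p + 1) * (q + 1)) • (symι σ y * symι σ x) := by
  have := RingQuot.mkAlgHom_rel K (SymRel.swap (σ := σ) p q x y hx hy)
  simpa [symι] using this

theorem sym_induction {C : SuspSym σ → Prop} (one : C 1) (add : ∀ a b, C a → C b → C (a + b))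
    (smul : ∀ (c : K) a, C a → C (c • a)) (mul : ∀ x a, C a → C (symι σ x * a)) (a : SuspSym σ) :
    C a := by
  obtain ⟨t, rfl⟩ := RingQuot.mkAlgHom_surjective K (SymRel σ) a
  have : ∀ t : TensorAlgebra K L, ∀ b, C b → C (RingQuot.mkAlgHom K (SymRel σ) t * b) := by
    intro t
    induction t using TensorAlgebra.induction with
    | algebraMap r => intro b hb; rw [AlgHom.commutes, ← Algebra.smul_def]; exact smul _ _ hb
    | ι x => intro b hb; exact mul x b hb
    | mul a b ha hb => intro c hc; rw [map_mul, mul_assoc]; exact ha _ (hb _ hc)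
    | add a b ha hb => intro c hc; rw [map_add, add_mul]; exact add _ _ (ha _ hc) (hb _ hc)
  simpa using this t 1 one

variable {N : Type*} [AddCommMonoid N] [Module K N]

/-- The compatibility of a recursion step with graded commutativity. -/
def SymStep (F : L →ₗ[K] (SuspSym σ × N) →ₗ[K] N) : Prop :=
  ∀ (p q : ℕ) (x y : L), σ x = (-1 : K) ^ p • x → σ y = (-1 : K) ^ q • y → ∀ w n,
    F x (symι σ y * w, F y (w, n)) =
      (-1 : K) ^ ((p + 1) * (q + 1)) • F y (symι σ x * w, F x (w, n))

/-- The action of a generator in the recursion below. -/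
noncomputable def symAct (F : L →ₗ[K] (SuspSym σ × N) →ₗ[K] N) : L →ₗ[K] Module.End K (SuspSym σ × N) :=
  LinearMap.mk₂ K (fun (x : L) (z : SuspSym σ × N) => (symι σ x * z.1, F x z))
      (by intros; simp [add_mul]) (by intros; simp) (by intros; simp [mul_add]) (by intros; simp)

theorem symAct_apply (F : L →ₗ[K] (SuspSym σ × N) →ₗ[K] N) (x : L) (z : SuspSym σ × N) :
    symAct F x z = (symι σ x * z.1, F x z) := rfl

theorem symAct_rel {F : L →ₗ[K] (SuspSym σ × N) →ₗ[K] N} (hF : SymStep F)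
    ⦃a b : TensorAlgebra K L⦄ (h : SymRel σ a b) :
    TensorAlgebra.lift K (symAct F) a = TensorAlgebra.lift K (symAct F) b := by
  obtain ⟨p, q, x, y, hx, hy⟩ := h
  apply LinearMap.ext
  rintro ⟨w, n⟩
  simp only [map_mul, map_smul, TensorAlgebra.lift_ι_apply, Module.End.mul_apply,
    LinearMap.smul_apply, symAct_apply]
  refine Prod.ext ?_ ?_
  · simp only [Prod.smul_fst, ← mul_assoc, symι_comm hx hy, smul_mul_assoc]
  · simp only [Prod.smul_snd]
    exact hF p q x y hx hy w n

/-- Recursion on symmetric products: `recS hF n₀ 1 = n₀` and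
`recS hF n₀ (x w) = F x (w, recS hF n₀ w)`. -/
noncomputable def recS {F : L →ₗ[K] (SuspSym σ × N) →ₗ[K] N} (hF : SymStep F) (n₀ : N) :
    SuspSym σ →ₗ[K] N :=
  LinearMap.snd K _ _ ∘ₗ LinearMap.applyₗ ((1 : SuspSym σ), n₀) ∘ₗ
    (RingQuot.liftAlgHom K ⟨TensorAlgebra.lift K (symAct F), symAct_rel hF⟩).toLinearMap

theorem recS_one {F : L →ₗ[K] (SuspSym σ × N) →ₗ[K] N} (hF : SymStep F) (n₀ : N) :
    recS hF n₀ 1 = n₀ := by simp [recS]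

theorem recS_cons {F : L →ₗ[K] (SuspSym σ × N) →ₗ[K] N} (hF : SymStep F) (n₀ : N) (x : L)
    (w : SuspSym σ) : recS hF n₀ (symι σ x * w) = F x (w, recS hF n₀ w) := by
  set Φ := RingQuot.liftAlgHom K ⟨TensorAlgebra.lift K (symAct F), symAct_rel hF⟩ with hΦ
  have hx : ∀ x, Φ (symι σ x) = symAct F x := by
    intro x
    rw [hΦ, symι, LinearMap.comp_apply, AlgHom.toLinearMap_apply,
      RingQuot.liftAlgHom_mkAlgHom_apply, TensorAlgebra.lift_ι_apply]
  have h : ∀ w : SuspSym σ, ∀ z, (Φ w z).1 = w * z.1 := by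
    intro w
    induction w using sym_induction with
    | one => intro z; simp
    | add a b ha hb => intro z; simp [ha, hb, add_mul]
    | smul c a ha => intro z; simp [ha]
    | mul x a ha => intro z; rw [map_mul, Module.End.mul_apply, hx, symAct_apply, ha, mul_assoc]
  have e : ∀ w, recS hF n₀ w = (Φ w (1, n₀)).2 := fun _ => rfl
  rw [e, map_mul, Module.End.mul_apply, hx, symAct_apply]
  change F x (Φ w (1, n₀)) = _
  congr 1
  refine Prod.ext ?_ rfl
  rw [h, mul_one]

end Sym

section CE
variable {K L : Type*} [Field K] [AddCommGroup L] [Module K L] {σ : L →ₗ[K] L}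

/-- The step of the recursion `ad_x (y w) = -(-1)^|x| [x, y] w + (-1)^(|x|(|y|+1)) y (ad_x w)`. -/
noncomputable def adStep (br : L →ₗ[K] L →ₗ[K] L) :
    L →ₗ[K] (SuspSym σ × (L →ₗ[K] SuspSym σ)) →ₗ[K] (L →ₗ[K] SuspSym σ) :=
  LinearMap.mk₂ K (fun y z => -(LinearMap.mulRight K z.1 ∘ₗ symι σ ∘ₗ br.flip y ∘ₗ σ) +
      LinearMap.mulLeft K (symι σ (odPart σ y)) ∘ₗ z.2 +
      LinearMap.mulLeft K (symι σ (evPart σ y)) ∘ₗ z.2 ∘ₗ σ)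
    (by intros; ext; simp [add_mul]; abel) (by intros; ext; simp)
    (by intros; ext; simp [mul_add]; abel) (by intros; ext; simp)

variable [CharZero K]

theorem adStep_eq (br : L →ₗ[K] L →ₗ[K] L) {p q : ℕ} {x y : L} (hx : σ x = (-1 : K) ^ p • x)
    (hy : σ y = (-1 : K) ^ q • y) (w : SuspSym σ) (n : L →ₗ[K] SuspSym σ) :
    adStep br y (w, n) x = (-1 : K) ^ (p + 1) • (symι σ (br x y) * w) +
      (-1 : K) ^ (p * (q + 1)) • (symι σ y * n x) := by
  simp only [adStep, LinearMap.mk₂_apply, LinearMap.add_apply, LinearMap.neg_apply,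
    LinearMap.comp_apply, LinearMap.mulRight_apply, LinearMap.mulLeft_apply, LinearMap.flip_apply,
    evPart_eq hy, odPart_eq hy, hx]
  rw [mul_comm p, pow_mul, pow_succ (-1 : K) p]
  split_ifs with h
  · rw [(h.add_one).neg_one_pow]; simp; module
  · rw [((Nat.not_even_iff_odd.1 h).add_one).neg_one_pow]; simp; module

variable (hσ : ∀ x, σ (σ x) = x) {br : L →ₗ[K] L →ₗ[K] L}
  (hbr : ∀ x y, σ (br x y) = br (σ x) (σ y))

theorem adStep_symStep (hσ : ∀ x, σ (σ x) = x)
    (hbr : ∀ x y, σ (br x y) = br (σ x) (σ y)) : SymStep (adStep (σ := σ) br) := by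
  intro q r y z hy hz w n
  apply LinearMap.ext
  intro x
  induction x using hom_span hσ with
  | hadd x x' h1 h2 => rw [map_add, map_add, h1, h2]
  | h p x hx =>
    have hxy : σ (br x y) = (-1 : K) ^ (p + q) • br x y := by
      rw [hbr, hx, hy]; simp [smul_smul, pow_add, mul_comm]
    have hxz : σ (br x z) = (-1 : K) ^ (p + r) • br x z := by
      rw [hbr, hx, hz]; simp [smul_smul, pow_add, mul_comm]
    rw [LinearMap.smul_apply, adStep_eq br hx hy, adStep_eq br hx hz, adStep_eq br hx hz,
      adStep_eq br hx hy]
    have e1 := symι_comm hxy hz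
    have e2 := symι_comm hxz hy
    have e3 := symι_comm hy hz
    simp only [mul_add (symι σ _), mul_smul_comm, ← mul_assoc, e1, e2, e3, smul_mul_assoc]
    rcases neg_one_pow_eq_or K p with h1 | h1 <;> rcases neg_one_pow_eq_or K q with h2 | h2 <;>
      rcases neg_one_pow_eq_or K r with h3 | h3 <;>
      simp only [pow_mul, pow_add, h1, h2, h3, pow_one, one_mul, one_pow, mul_one, neg_mul,
        neg_neg] <;> module

/-- `adSym w x` is the part of the codifferential that contracts the generator `x` with the
generators in the product `w`. -/
noncomputable def adSym : SuspSym σ →ₗ[K] L →ₗ[K] SuspSym σ :=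
  recS (adStep_symStep hσ hbr) 0

/-- The step of the recursion `d (x w) = (δ x) w + (-1)^(|x|+1) x (d w) + ad_x w`. -/
noncomputable def dStep (δ : L →ₗ[K] L) : L →ₗ[K] (SuspSym σ × SuspSym σ) →ₗ[K] SuspSym σ :=
  LinearMap.mk₂ K (fun x z => symι σ (δ x) * z.1 - symι σ (σ x) * z.2 + adSym hσ hbr z.1 x)
    (by intros; simp [add_mul]; abel) (by intros; simp [smul_sub])
    (by intros; simp [mul_add]; abel) (by intros; simp [smul_sub])

theorem adSym_cons {p q : ℕ} {x y : L} (hx : σ x = (-1 : K) ^ p • x)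
    (hy : σ y = (-1 : K) ^ q • y) (w : SuspSym σ) :
    adSym hσ hbr (symι σ y * w) x = (-1 : K) ^ (p + 1) • (symι σ (br x y) * w) +
      (-1 : K) ^ (p * (q + 1)) • (symι σ y * adSym hσ hbr w x) := by
  rw [adSym, recS_cons, adStep_eq br hx hy]

theorem dStep_symStep (hba : ∀ p q x y, σ x = (-1 : K) ^ p • x → σ y = (-1 : K) ^ q • y →
      br x y = -((-1 : K) ^ (p * q) • br y x))
    {δ : L →ₗ[K] L} (hδ : ∀ x, σ (δ x) = -δ (σ x)) : SymStep (dStep hσ hbr δ) := by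
  intro p q x y hx hy w n
  have hδx : σ (δ x) = (-1 : K) ^ (p + 1) • δ x := by rw [hδ, hx]; simp [pow_succ]
  have hδy : σ (δ y) = (-1 : K) ^ (q + 1) • δ y := by rw [hδ, hy]; simp [pow_succ]
  simp only [dStep, LinearMap.mk₂_apply]
  have hba' : br x y = (-1 : K) ^ (p * q + 1) • br y x := by
    rw [hba p q x y hx hy, pow_succ]; simp
  rw [adSym_cons hσ hbr hx hy, adSym_cons hσ hbr hy hx, hba', hx, hy]
  have e1 := symι_comm hδx hy
  have e2 := symι_comm hx hδy
  have e3 := symι_comm hx hy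
  simp only [map_smul, smul_mul_assoc, mul_add (symι σ _), mul_sub (symι σ _), mul_smul_comm,
    ← mul_assoc, e1, e2, e3]
  rcases neg_one_pow_eq_or K p with h1 | h1 <;> rcases neg_one_pow_eq_or K q with h2 | h2 <;>
    simp only [pow_mul, pow_add, h1, h2, pow_one, one_mul, one_pow, mul_one, neg_mul,
      neg_neg] <;> module

/-- The codifferential of the symmetric coalgebra of the desuspension of a differential graded
Lie algebra: the coderivation with components `δ` and `(x, y) ↦ -(-1)^|x| [x, y]`. -/
noncomputable def dSym (hba : ∀ p q x y, σ x = (-1 : K) ^ p • x → σ y = (-1 : K) ^ q • y →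
      br x y = -((-1 : K) ^ (p * q) • br y x))
    {δ : L →ₗ[K] L} (hδ : ∀ x, σ (δ x) = -δ (σ x)) : SuspSym σ →ₗ[K] SuspSym σ :=
  recS (dStep_symStep hσ hbr hba hδ) 0

theorem dSym_cons (hba : ∀ p q x y, σ x = (-1 : K) ^ p • x → σ y = (-1 : K) ^ q • y →
      br x y = -((-1 : K) ^ (p * q) • br y x))
    {δ : L →ₗ[K] L} (hδ : ∀ x, σ (δ x) = -δ (σ x)) (x : L) (w : SuspSym σ) :
    dSym hσ hbr hba hδ (symι σ x * w) = symι σ (δ x) * w -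
      symι σ (σ x) * dSym hσ hbr hba hδ w + adSym hσ hbr w x := by
  rw [dSym, recS_cons]; rfl

variable (σ) in
/-- The span of the nonempty symmetric products: the underlying space of the cofree cocommutative
coalgebra (without counit) cogenerated by the desuspension of `L`. -/
def posSym : Submodule K (SuspSym σ) := Submodule.span K {c | ∃ x w, c = symι σ x * w}

theorem symι_mul_mem (x : L) (w : SuspSym σ) : symι σ x * w ∈ posSym σ :=
  Submodule.subset_span ⟨x, w, rfl⟩

theorem adSym_mem (x : L) (w : SuspSym σ) : adSym hσ hbr w x ∈ posSym σ := by
  induction x using hom_span hσ with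
  | hadd x x' h1 h2 => rw [map_add]; exact add_mem h1 h2
  | h p x hx =>
    induction w using sym_induction with
    | one => rw [adSym, recS_one]; exact zero_mem _
    | add a b ha hb => rw [map_add]; exact add_mem ha hb
    | smul c a ha => rw [map_smul]; exact Submodule.smul_mem _ _ ha
    | mul y a ha =>
      induction y using hom_span hσ with
      | hadd y y' h1 h2 => rw [map_add, add_mul, map_add]; exact add_mem h1 h2
      | h q y hy =>
        rw [adSym_cons hσ hbr hx hy]
        exact add_mem (Submodule.smul_mem _ _ (symι_mul_mem _ _))
          (Submodule.smul_mem _ _ (symι_mul_mem _ _))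

theorem dSym_mem (hba : ∀ p q x y, σ x = (-1 : K) ^ p • x → σ y = (-1 : K) ^ q • y →
      br x y = -((-1 : K) ^ (p * q) • br y x))
    {δ : L →ₗ[K] L} (hδ : ∀ x, σ (δ x) = -δ (σ x)) (w : SuspSym σ) (hw : w ∈ posSym σ) :
    dSym hσ hbr hba hδ w ∈ posSym σ := by
  induction hw using Submodule.span_induction with
  | mem w hw =>
    obtain ⟨x, w, rfl⟩ := hw
    rw [dSym_cons]
    exact add_mem (sub_mem (symι_mul_mem _ _) (symι_mul_mem _ _)) (adSym_mem hσ hbr _ _)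
  | zero => rw [map_zero]; exact zero_mem _
  | add x y _ _ h1 h2 => rw [map_add]; exact add_mem h1 h2
  | smul c x _ h => rw [map_smul]; exact Submodule.smul_mem _ _ h

end CE

noncomputable section Gerstenhaber
variable {K V : Type*} [Field K] [Ring V] [Algebra K V]

/-- A (non-negatively graded) Gerstenhaber algebra structure on a graded algebra `V`: the product
is graded commutative and there is a graded Lie bracket of degree `-1` which satisfies the graded
Leibniz rule. -/
structure Gerstenhaber (𝒱 : ℕ → Submodule K V) [GradedAlgebra 𝒱] where
  mul_comm : ∀ p q x y, x ∈ 𝒱 p → y ∈ 𝒱 q → x * y = (-1 : K) ^ (p * q) • (y * x)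
  bracket : V →ₗ[K] V →ₗ[K] V
  bracket_zero : ∀ x y, x ∈ 𝒱 0 → y ∈ 𝒱 0 → bracket x y = 0
  bracket_mem : ∀ p q r x y, x ∈ 𝒱 p → y ∈ 𝒱 q → p + q = r + 1 → bracket x y ∈ 𝒱 r
  antisymm : ∀ p q x y, x ∈ 𝒱 p → y ∈ 𝒱 q →
    bracket x y = -((-1 : K) ^ ((p + 1) * (q + 1)) • bracket y x)
  leibniz : ∀ p q x y z, x ∈ 𝒱 p → y ∈ 𝒱 q →
    bracket x (y * z) = bracket x y * z + (-1 : K) ^ ((p + 1) * q) • (y * bracket x z)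
  jacobi : ∀ p q x y z, x ∈ 𝒱 p → y ∈ 𝒱 q →
    bracket x (bracket y z) = bracket (bracket x y) z +
      (-1 : K) ^ ((p + 1) * (q + 1)) • bracket y (bracket x z)

variable (𝒱 : ℕ → Submodule K V) [GradedAlgebra 𝒱]

/-- The parity involution of the desuspension of `V`: it is `(-1)^(n-1)` on the degree `n` part. -/
def suspParity : V →ₗ[K] V :=
  DirectSum.toModule K ℕ V (fun n => (-1 : K) ^ (n + 1) • (𝒱 n).subtype) ∘ₗ
    (DirectSum.decomposeLinearEquiv 𝒱).toLinearMap

variable {𝒱}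

theorem suspParity_eq {n : ℕ} {x : V} (hx : x ∈ 𝒱 n) : suspParity 𝒱 x = (-1 : K) ^ (n + 1) • x := by
  simp only [suspParity, LinearMap.comp_apply, LinearEquiv.coe_coe,
    DirectSum.decomposeLinearEquiv_apply, DirectSum.decompose_of_mem 𝒱 hx]
  change DirectSum.toModule K ℕ V _ (DirectSum.lof K ℕ (fun i => 𝒱 i) n ⟨x, hx⟩) = _
  rw [DirectSum.toModule_lof]; rfl

variable (𝒱) in
theorem graded_span (C : V → Prop) (hadd : ∀ x y, C x → C y → C (x + y))
    (h : ∀ n, ∀ x ∈ 𝒱 n, C x) (x : V) : C x := by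
  classical
  rw [← DirectSum.sum_support_decompose 𝒱 x]
  exact Finset.sum_induction _ C hadd (h 0 0 (zero_mem _)) fun i _ => h i _ (SetLike.coe_mem _)

variable (𝒱) in
theorem suspParity_suspParity (x : V) : suspParity 𝒱 (suspParity 𝒱 x) = x := by
  induction x using graded_span 𝒱 with
  | hadd x y h1 h2 => rw [map_add, map_add, h1, h2]
  | h n x hx =>
    rw [suspParity_eq hx, map_smul, suspParity_eq hx, smul_smul, ← pow_add, ← mul_two,
      neg_one_pow_mul_two, one_smul]

theorem parity_of_degree (B : V →ₗ[K] V →ₗ[K] V)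
    (hB : ∀ m n x y, x ∈ 𝒱 m → y ∈ 𝒱 n → B x y = -((-1 : K) ^ ((m + 1) * (n + 1)) • B y x))
    (p q : ℕ) (x y : V) (hx : suspParity 𝒱 x = (-1 : K) ^ p • x)
    (hy : suspParity 𝒱 y = (-1 : K) ^ q • y) : B x y = -((-1 : K) ^ (p * q) • B y x) := by
  have h1 : ∀ m, ∀ x ∈ 𝒱 m, B x y = -((-1 : K) ^ ((m + 1) * q) • B y x) := by
    intro m x hx
    have : ∀ y, B x y = -B (if Even (m + 1) then y else suspParity 𝒱 y) x := by
      intro y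
      induction y using graded_span 𝒱 with
      | hadd y y' h1 h2 =>
        rw [map_add, h1, h2]; split_ifs <;> simp [add_comm]
      | h n y hy =>
        rw [hB m n x y hx hy, pow_mul]
        split_ifs with h
        · rw [h.neg_one_pow]; simp
        · rw [(Nat.not_even_iff_odd.1 h).neg_one_pow, suspParity_eq hy]; simp
    rw [this y, pow_mul]
    split_ifs with h
    · rw [h.neg_one_pow]; simp
    · rw [(Nat.not_even_iff_odd.1 h).neg_one_pow, hy]; simp
  have h2 : ∀ x, B x y = -B y (if Even q then x else suspParity 𝒱 x) := by
    intro x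
    induction x using graded_span 𝒱 with
    | hadd x x' h1 h2 => rw [map_add, LinearMap.add_apply, h1, h2]; split_ifs <;> simp [add_comm]
    | h m x hx =>
      rw [h1 m x hx, mul_comm, pow_mul]
      split_ifs with h
      · rw [h.neg_one_pow]; simp
      · rw [(Nat.not_even_iff_odd.1 h).neg_one_pow, suspParity_eq hx]; simp
  rw [h2 x, mul_comm p q, pow_mul]
  split_ifs with h
  · rw [h.neg_one_pow]; simp
  · rw [(Nat.not_even_iff_odd.1 h).neg_one_pow, hx]; simp

variable (𝒱) in
/-- The product as a map of degree one on the desuspension: `(x, y) ↦ (-1)^p x y` for `x` of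
degree `p` in `V`. -/
def suspMul : V →ₗ[K] V →ₗ[K] V := -(LinearMap.mul K V ∘ₗ suspParity 𝒱)

theorem suspMul_eq {p : ℕ} {x : V} (hx : x ∈ 𝒱 p) (y : V) :
    suspMul 𝒱 x y = (-1 : K) ^ p • (x * y) := by
  simp [suspMul, suspParity_eq hx, pow_succ]

variable (𝒱) in
theorem suspMul_parity (x y : V) :
    suspParity 𝒱 (suspMul 𝒱 x y) = -suspMul 𝒱 (suspParity 𝒱 x) (suspParity 𝒱 y) := by
  induction x using graded_span 𝒱 with
  | hadd x x' h1 h2 => simp only [map_add, LinearMap.add_apply, h1, h2]; abel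
  | h m x hx =>
    induction y using graded_span 𝒱 with
    | hadd y y' h1 h2 => simp only [map_add, h1, h2]; abel
    | h n y hy =>
      rw [suspMul_eq hx, map_smul, suspParity_eq (SetLike.GradedMul.mul_mem hx hy),
        suspParity_eq hx, suspParity_eq hy, map_smul, map_smul, LinearMap.smul_apply, suspMul_eq hx]
      match_scalars
      ring

namespace Gerstenhaber
variable (G : Gerstenhaber 𝒱)

theorem bracket_parity (x y : V) : suspParity 𝒱 (G.bracket x y) =
    G.bracket (suspParity 𝒱 x) (suspParity 𝒱 y) := by
  induction x using graded_span 𝒱 with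
  | hadd x x' h1 h2 => simp only [map_add, LinearMap.add_apply, h1, h2]
  | h m x hx =>
    induction y using graded_span 𝒱 with
    | hadd y y' h1 h2 => simp only [map_add, h1, h2]
    | h n y hy =>
      rw [suspParity_eq hx, suspParity_eq hy, map_smul, map_smul, LinearMap.smul_apply]
      rcases Nat.eq_zero_or_pos (m + n) with h | h
      · obtain ⟨rfl, rfl⟩ : m = 0 ∧ n = 0 := by omega
        rw [G.bracket_zero x y hx hy]; simp
      · obtain ⟨r, hr⟩ : ∃ r, m + n = r + 1 := ⟨m + n - 1, by omega⟩
        rw [suspParity_eq (G.bracket_mem m n r x y hx hy hr), ← hr, smul_smul]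
        congr 1
        ring

theorem bracket_antisymm (p q : ℕ) (x y : V) (hx : suspParity 𝒱 x = (-1 : K) ^ p • x)
    (hy : suspParity 𝒱 y = (-1 : K) ^ q • y) :
    G.bracket x y = -((-1 : K) ^ (p * q) • G.bracket y x) :=
  parity_of_degree G.bracket G.antisymm p q x y hx hy

theorem suspMul_comm (G : Gerstenhaber 𝒱) (p q : ℕ) (x y : V) (hx : suspParity 𝒱 x = (-1 : K) ^ p • x)
    (hy : suspParity 𝒱 y = (-1 : K) ^ q • y) :
    suspMul 𝒱 x y = -((-1 : K) ^ (p * q) • suspMul 𝒱 y x) := by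
  refine parity_of_degree (suspMul 𝒱) (fun m n x y hx hy => ?_) p q x y hx hy
  rw [suspMul_eq hx, suspMul_eq hy, G.mul_comm m n x y hx hy]
  match_scalars
  ring_nf
  simp only [neg_one_pow_mul_two, mul_one]

end Gerstenhaber

variable (𝒱) in
/-- The cofree Lie coalgebra cogenerated by the desuspension of `V`. -/
abbrev BarColie := CofreeLie (suspParity 𝒱)

variable [CharZero K]

variable (𝒱) in
/-- The parity involution of the cofree Lie coalgebra; it multiplies the class of a homogeneous
word by the sign given by its total degree. -/
def colieParity : BarColie 𝒱 →ₗ[K] BarColie 𝒱 :=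
  Submodule.mapQ _ _ (par (suspParity 𝒱)).toLinearMap
    (fun _ hw => par_mem (suspParity_suspParity 𝒱) hw)

theorem colieParity_mk (a : TensorAlgebra K V) : colieParity 𝒱 (Submodule.mkQ _ a) =
    Submodule.mkQ _ (par (suspParity 𝒱) a) := rfl

variable (𝒱) in
theorem colieParity_colieParity (x : BarColie 𝒱) : colieParity 𝒱 (colieParity 𝒱 x) = x := by
  obtain ⟨x, rfl⟩ := Submodule.mkQ_surjective _ x
  rw [colieParity_mk, colieParity_mk, par_par (suspParity_suspParity 𝒱)]

namespace Gerstenhaber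
variable (G : Gerstenhaber 𝒱)

/-- The codifferential of the cofree Lie coalgebra that comes from the product of `V`; its
corestriction to `V` is `(x, y) ↦ (-1)^p x y` for `x` of degree `p` in `V`. -/
def colieDiff : BarColie 𝒱 →ₗ[K] BarColie 𝒱 :=
  Submodule.mapQ _ _ (harr (suspParity 𝒱) (suspMul 𝒱)) (fun _ hw =>
    harr_mem (suspMul 𝒱) (suspParity_suspParity 𝒱) (suspMul_parity 𝒱) G.suspMul_comm hw)

/-- The Lie bracket on the cofree Lie coalgebra that comes from the bracket of `V`; its
corestriction to `V` is the bracket of the corestrictions. -/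
def colieBracket : BarColie 𝒱 →ₗ[K] BarColie 𝒱 →ₗ[K] BarColie 𝒱 :=
  Submodule.liftQ _
    { toFun := fun a => Submodule.mapQ _ _ (wordBracket (suspParity 𝒱) G.bracket a) (fun _ hw =>
        wordBracket_mem_right G.bracket (suspParity_suspParity 𝒱) G.bracket_parity
          (fun p q x y hx hy => by
            rw [G.bracket_antisymm q p y x hy hx, Nat.mul_comm]) hw a)
      map_add' := fun a b => by apply Submodule.linearMap_qext; ext; simp
      map_smul' := fun c a => by apply Submodule.linearMap_qext; ext; simp }
    (fun w hw => by
      apply Submodule.linearMap_qext; ext c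
      simpa using wordBracket_mem_left G.bracket (suspParity_suspParity 𝒱) G.bracket_parity hw c)

theorem colieBracket_mk (a b : TensorAlgebra K V) :
    G.colieBracket (Submodule.mkQ _ a) (Submodule.mkQ _ b) =
      Submodule.mkQ _ (wordBracket (suspParity 𝒱) G.bracket a b) := rfl

theorem colieDiff_mk (a : TensorAlgebra K V) :
    G.colieDiff (Submodule.mkQ _ a) =
      Submodule.mkQ _ (harr (suspParity 𝒱) (suspMul 𝒱) a) := rfl

theorem colieDiff_parity (x : BarColie 𝒱) :
    colieParity 𝒱 (G.colieDiff x) = -G.colieDiff (colieParity 𝒱 x) := by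
  obtain ⟨x, rfl⟩ := Submodule.mkQ_surjective _ x
  rw [colieDiff_mk, colieParity_mk, colieParity_mk, colieDiff_mk,
    harr_par' (suspMul 𝒱) (suspParity_suspParity 𝒱) (suspMul_parity 𝒱), map_neg]

theorem colieBracket_parity (x y : BarColie 𝒱) : colieParity 𝒱 (G.colieBracket x y) =
    G.colieBracket (colieParity 𝒱 x) (colieParity 𝒱 y) := by
  obtain ⟨x, rfl⟩ := Submodule.mkQ_surjective _ x
  obtain ⟨y, rfl⟩ := Submodule.mkQ_surjective _ y
  rw [colieBracket_mk, colieParity_mk, colieParity_mk, colieParity_mk, colieBracket_mk,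
    wordBracket_par' G.bracket (suspParity_suspParity 𝒱) G.bracket_parity]

theorem lift_parity {p : ℕ} {x : BarColie 𝒱} (hx : colieParity 𝒱 x = (-1 : K) ^ p • x) :
    ∃ a, par (suspParity 𝒱) a = (-1 : K) ^ p • a ∧ Submodule.mkQ _ a = x := by
  obtain ⟨a, rfl⟩ := Submodule.mkQ_surjective _ x
  have hx' : Submodule.mkQ (shuffleSpan (suspParity 𝒱)) (par (suspParity 𝒱) a) =
      (-1 : K) ^ p • Submodule.mkQ _ a := hx
  have h2 : (-1 : K) ^ p * (-1) ^ p = 1 := by rw [← pow_add, ← mul_two, neg_one_pow_mul_two]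
  refine ⟨(2⁻¹ : K) • (a + (-1 : K) ^ p • par (suspParity 𝒱) a), ?_, ?_⟩
  · rw [map_smul, map_add, map_smul, par_par (suspParity_suspParity 𝒱)]
    rcases neg_one_pow_eq_or K p with h | h <;> rw [h] <;> module
  · rw [map_smul, map_add, map_smul, hx', smul_smul, h2, one_smul, ← two_smul K, smul_smul]
    simp

theorem colieBracket_antisymm (p q : ℕ) (x y : BarColie 𝒱)
    (hx : colieParity 𝒱 x = (-1 : K) ^ p • x) (hy : colieParity 𝒱 y = (-1 : K) ^ q • y) :
    G.colieBracket x y = -((-1 : K) ^ (p * q) • G.colieBracket y x) := by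
  obtain ⟨a, ha, rfl⟩ := lift_parity hx
  obtain ⟨b, hb, rfl⟩ := lift_parity hy
  rw [colieBracket_mk, colieBracket_mk, wordBracket_antisymm' G.bracket (suspParity_suspParity 𝒱)
    (fun p q x y hx hy => by rw [G.bracket_antisymm q p y x hy hx, Nat.mul_comm]) hb ha,
    map_neg, map_smul, Nat.mul_comm]

end Gerstenhaber

variable (𝒱) in
/-- The cofree `e₂^∨`-coalgebra cogenerated by `V`: nonempty symmetric products of elements of the
desuspension of the cofree Lie coalgebra of the desuspension of `V`. -/
abbrev BarE2 := posSym (colieParity 𝒱)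

/-- The codifferential of the bar construction of a Gerstenhaber algebra: the Chevalley-Eilenberg
codifferential of the differential graded Lie algebra `BarColie 𝒱`. It satisfies
`d (X w) = (δ X) w + (-1)^(|X|+1) X (d w) + ad_X w`, where `δ` is the Harrison codifferential that
comes from the product of `V` and `ad_X` contracts `X` with the factors of `w` by means of the Lie
bracket that comes from the bracket of `V`. -/
def Gerstenhaber.codifferential (G : Gerstenhaber 𝒱) : BarE2 𝒱 →ₗ[K] BarE2 𝒱 :=
  (dSym (colieParity_colieParity 𝒱) G.colieBracket_parity G.colieBracket_antisymm
    G.colieDiff_parity).restrict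
    (dSym_mem (colieParity_colieParity 𝒱) G.colieBracket_parity G.colieBracket_antisymm
      G.colieDiff_parity)

end Gerstenhaber

noncomputable section Xi
variable (K A : Type*) [Field K] [CharZero K] [CommRing A] [Algebra K A]

/-- The Gerstenhaber algebra of polyvector fields. -/
def polyvecGerstenhaber : Gerstenhaber (polyvecDeg K A) where
  mul_comm _ _ _ _ hx hy := polyvec_comm hx hy
  bracket := schouten K A
  bracket_zero _ _ hx hy := schouten_spec.zero hx hy
  bracket_mem := schouten_spec.mem
  antisymm := schouten_spec.antisymm
  leibniz := schouten_spec.leibniz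
  jacobi _ _ _ _ z hx hy := schouten_spec.jacobi z hx hy

variable {K A} in
/-- A function or a derivation as a polyvector field. -/
def xiLetter : A ⊕ Derivation K A A → Polyvec K A :=
  Sum.elim (algebraMap A _) (ExteriorAlgebra.ι A)

/-- The subspace of the cofree Lie coalgebra spanned by the monomials in functions and derivations
in which a derivation appears at most once, that is, the sum of the cofree Lie coalgebra cogenerated
by the functions and of the cofree comodule over it cogenerated by the derivations. -/
def colieXi : Submodule K (BarColie (polyvecDeg K A)) :=
  Submodule.span K {c | ∃ l : List (A ⊕ Derivation K A A), l.countP Sum.isRight ≤ 1 ∧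
    c = Submodule.mkQ _ (l.map fun x => TensorAlgebra.ι K (xiLetter x)).prod}

/-- The subcoalgebra `Ξ(A)`: sums of nonempty symmetric products of elements of `colieXi`. -/
def Xi : Submodule K (BarE2 (polyvecDeg K A)) :=
  Submodule.span K {c | ∃ L : List (BarColie (polyvecDeg K A)), L ≠ [] ∧
    (∀ X ∈ L, X ∈ colieXi K A) ∧ c.1 = (L.map (symι (colieParity (polyvecDeg K A)))).prod}

end Xi

end Gerst

/-! The proof counts derivations, and rests on two facts about the letters $A\oplus\mathrm{Der}(A)$.
First, the product of two letters of which at most one is a derivation is again a letter with the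
same total number of derivations: $ab\in A$, $aX\in\mathrm{Der}(A)$. Secondly, the Schouten bracket
of two letters is zero or a letter, with one derivation less than its arguments have together:
$[a,b]=0$, $[X,a]=X(a)\in A$, $[X,Y]\in\mathrm{Der}(A)$.

Therefore the Harrison codifferential, which multiplies two adjacent letters, sends a word with at
most one derivation to a combination of such words. The bivector $X\wedge Y$, which is not a letter,
could only arise from a word with two derivations. Shuffling adds the numbers of derivations of two
words, and the Lie bracket of two words also contracts one pair of letters; so the bracket of two
words with at most one derivation each consists of words with at most $1+1-1=1$ derivation. These
are `harr_mem_xiFil`, `shuffle_mem_xiFil` and `wordBracket_mem_xiFil`. Koszul signs do not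
interfere, because functions and derivations are homogeneous: every sign operator acts on such a
letter or word by a scalar.

Consequently `colieXi` is a DG Lie subalgebra $M$ of $L$ (`colieDiff_mem_colieXi`,
`colieBracket_mem_colieXi`), stable under the parity involution. The components of the
Chevalley–Eilenberg codifferential are the differential and the bracket up to sign, so it maps
symmetric products of elements of $M$ to sums of symmetric products of elements of $M$
(`dSym_mem_posSymProd`). With this $M$ these products span $\Xi(A)$.

The count is organised by `xiFil n`, with fewer than `n` derivations. The strict inequality makes
`xiFil 0` the zero space, so the rule that a bracket loses one derivation also covers words in
functions only, whose bracket vanishes. -/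

namespace Gerst

/-! ### Words in functions and derivations, filtered by the number of derivations. -/

section XiWords
open TensorAlgebra
variable {K A : Type*} [Field K] [CommRing A] [Algebra K A]

/-- The number of derivations among the letters of a word in functions and derivations. -/
def derCount (l : List (A ⊕ Derivation K A A)) : ℕ := l.countP Sum.isRight

theorem derCount_cons (x : A ⊕ Derivation K A A) (l : List (A ⊕ Derivation K A A)) :
    derCount (x :: l) = derCount [x] + derCount l := by
  simp [derCount, List.countP_cons, Nat.add_comm]

@[simp] theorem derCount_nil : derCount ([] : List (A ⊕ Derivation K A A)) = 0 := rfl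

@[simp] theorem derCount_inl (a : A) : derCount [(Sum.inl a : A ⊕ Derivation K A A)] = 0 := rfl

@[simp] theorem derCount_inr (X : Derivation K A A) :
    derCount [(Sum.inr X : A ⊕ Derivation K A A)] = 1 := rfl

/-- The word in polyvector fields given by a list of functions and derivations. -/
noncomputable def xiWord (l : List (A ⊕ Derivation K A A)) : TensorAlgebra K (Polyvec K A) :=
  (l.map fun x => ι K (xiLetter x)).prod

@[simp] theorem xiWord_nil : xiWord ([] : List (A ⊕ Derivation K A A)) = 1 := rfl

theorem xiWord_cons (x : A ⊕ Derivation K A A) (l : List (A ⊕ Derivation K A A)) :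
    xiWord (x :: l) = ι K (xiLetter x) * xiWord l := by simp [xiWord]

variable (K A) in
/-- The span of the words in functions and derivations with less than `n` derivations. -/
noncomputable def xiFil (n : ℕ) : Submodule K (TensorAlgebra K (Polyvec K A)) :=
  Submodule.span K {w | ∃ l : List (A ⊕ Derivation K A A), derCount l < n ∧ w = xiWord l}

theorem xiWord_mem {l : List (A ⊕ Derivation K A A)} {n : ℕ} (h : derCount l < n) :
    xiWord l ∈ xiFil K A n :=
  Submodule.subset_span ⟨l, h, rfl⟩

/-- Prepending a letter adds its own count. The slack in the inequality builds in the monotonicity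
of the filtration, so that later bounds reduce to linear arithmetic. -/
theorem ι_mul_mem_xiFil {x : A ⊕ Derivation K A A} {w : TensorAlgebra K (Polyvec K A)} {m n : ℕ}
    (hw : w ∈ xiFil K A n) (h : derCount [x] + n ≤ m) : ι K (xiLetter x) * w ∈ xiFil K A m := by
  induction hw using Submodule.span_induction with
  | mem w hw =>
    obtain ⟨l, hl, rfl⟩ := hw
    rw [← xiWord_cons]
    exact xiWord_mem (by rw [derCount_cons]; omega)
  | zero => simp
  | add a b _ _ ha hb => rw [mul_add]; exact add_mem ha hb
  | smul c a _ ha => rw [mul_smul_comm]; exact Submodule.smul_mem _ _ ha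

/-- Parity refers to the desuspension, where degrees are lowered by one: functions become odd and
derivations even. -/
theorem suspParity_inl (a : A) : suspParity (polyvecDeg K A) (xiLetter (Sum.inl a)) =
    -xiLetter (Sum.inl a) := by
  rw [xiLetter, Sum.elim_inl, suspParity_eq (alg_mem a)]; simp

theorem suspParity_inr (X : Derivation K A A) :
    suspParity (polyvecDeg K A) (xiLetter (Sum.inr X)) = xiLetter (Sum.inr X) := by
  rw [xiLetter, Sum.elim_inr, suspParity_eq (ι_mem X)]; simp

/-- Only the existence of an eigenvalue matters, since spans do not see scalars. The even and odd
parts of a letter are linear combinations of the letter and its parity image, hence are multiples of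
it as well, and so is the parity image of a whole word. -/
theorem suspParity_xiLetter (x : A ⊕ Derivation K A A) :
    ∃ c : K, suspParity (polyvecDeg K A) (xiLetter x) = c • xiLetter x := by
  rcases x with a | X
  · exact ⟨-1, by rw [suspParity_inl, neg_one_smul]⟩
  · exact ⟨1, by rw [suspParity_inr, one_smul]⟩

theorem evPart_xiLetter (x : A ⊕ Derivation K A A) :
    ∃ c : K, evPart (suspParity (polyvecDeg K A)) (xiLetter x) = c • xiLetter x := by
  obtain ⟨c, hc⟩ := suspParity_xiLetter x
  exact ⟨2⁻¹ * (1 + c), by simp [evPart, hc]; module⟩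

theorem odPart_xiLetter (x : A ⊕ Derivation K A A) :
    ∃ c : K, odPart (suspParity (polyvecDeg K A)) (xiLetter x) = c • xiLetter x := by
  obtain ⟨c, hc⟩ := suspParity_xiLetter x
  exact ⟨2⁻¹ * (1 - c), by simp [odPart, hc]; module⟩

theorem par_xiWord (l : List (A ⊕ Derivation K A A)) :
    ∃ c : K, par (suspParity (polyvecDeg K A)) (xiWord l) = c • xiWord l := by
  induction l with
  | nil => exact ⟨1, by simp⟩
  | cons x l ih =>
    obtain ⟨c, hc⟩ := ih
    obtain ⟨d, hd⟩ := suspParity_xiLetter x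
    exact ⟨d * c, by rw [xiWord_cons, map_mul, par_ι, hd, hc, map_smul, smul_mul_smul_comm]⟩

/-- In each summand $u\,G(v)$ the prefix $u$ is left untouched, so a bound for $G$ that is additive
in the number of derivations of $v$ carries over to the sum. Here `k` is the amount by which `G` may
raise the level; in the applications it comes from the second word. -/
theorem tailSum_mem_xiFil {G : TensorAlgebra K (Polyvec K A) →ₗ[K] TensorAlgebra K (Polyvec K A)}
    {k : ℕ} (hG : ∀ l n, derCount l + k ≤ n → G (xiWord l) ∈ xiFil K A n)
    (l : List (A ⊕ Derivation K A A)) (n : ℕ) (h : derCount l + k ≤ n) :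
    tailSum G (xiWord l) ∈ xiFil K A n := by
  induction l generalizing n with
  | nil =>
    rw [xiWord_nil, tailSum_one, ← xiWord_nil]
    exact hG _ _ h
  | cons x l ih =>
    rw [xiWord_cons, tailSum_cons, ← xiWord_cons]
    refine add_mem (ι_mul_mem_xiFil (ih _ le_rfl) ?_) (hG _ _ h)
    rw [derCount_cons] at h; omega

/-- Up to scalars, both summands of `passLetter` are the letter `y` followed by the value of `G` at
the given word, since the word is an eigenvector of the parity. -/
theorem passLetter_mem_xiFil
    {G : TensorAlgebra K (Polyvec K A) →ₗ[K] TensorAlgebra K (Polyvec K A)}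
    {l : List (A ⊕ Derivation K A A)} {n m : ℕ} (hG : G (xiWord l) ∈ xiFil K A n)
    (y : A ⊕ Derivation K A A) (h : derCount [y] + n ≤ m) :
    passLetter (suspParity (polyvecDeg K A)) (xiLetter y) G (xiWord l) ∈ xiFil K A m := by
  obtain ⟨c, hc⟩ := evPart_xiLetter y
  obtain ⟨d, hd⟩ := odPart_xiLetter y
  obtain ⟨e, he⟩ := par_xiWord l
  simp only [passLetter, LinearMap.mk₂_apply, LinearMap.add_apply, LinearMap.comp_apply,
    LinearMap.mulLeft_apply, AlgHom.toLinearMap_apply, hc, hd, he, map_smul, smul_mul_assoc]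
  exact add_mem (Submodule.smul_mem _ _ (ι_mul_mem_xiFil hG h))
    (Submodule.smul_mem _ _ (Submodule.smul_mem _ _ (ι_mul_mem_xiFil hG h)))

/-- Shuffling only rearranges letters, so the numbers of derivations add up. The extra $1$
translates this count into the strict bound of `xiFil`. -/
theorem shuffle_mem_xiFil (l m : List (A ⊕ Derivation K A A)) (n : ℕ)
    (h : derCount l + (derCount m + 1) ≤ n) :
    shuffle (suspParity (polyvecDeg K A)) (xiWord l) (xiWord m) ∈ xiFil K A n := by
  induction m generalizing l n with
  | nil =>
    rw [xiWord_nil, shuffle_one]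
    exact xiWord_mem (by rw [derCount_nil] at h; omega)
  | cons y m ih =>
    rw [xiWord_cons, shuffle_cons_right]
    -- For every suffix `l'` of the first word the induction hypothesis is taken at its lowest
    -- level, `derCount l' + (derCount m + 1)`; prepending `y` then accounts exactly for passing
    -- from `m` to `y :: m`.
    refine tailSum_mem_xiFil (fun l' n' h' => passLetter_mem_xiFil
      (by rw [LinearMap.flip_apply]; exact ih l' _ le_rfl) y ?_) l n h
    rw [derCount_cons] at h'; omega

/-! ### The Harrison codifferential on words with at most one derivation. -/

/-- The product of two letters that are not both derivations is a letter. -/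
theorem suspMul_mul_mem_xiFil {x y : A ⊕ Derivation K A A} {w : TensorAlgebra K (Polyvec K A)}
    {m n : ℕ} (hw : w ∈ xiFil K A n) (h : derCount [x] + derCount [y] + n ≤ m)
    (hxy : derCount [x] + derCount [y] ≤ 1) :
    ι K (suspMul (polyvecDeg K A) (xiLetter x) (xiLetter y)) * w ∈ xiFil K A m := by
  obtain ⟨c, hc⟩ := suspParity_xiLetter x
  have hz : ∃ z : A ⊕ Derivation K A A, derCount [z] = derCount [x] + derCount [y] ∧
      xiLetter z = xiLetter x * xiLetter y := by
    -- The product letter is $ab$, $aY$ or $bX$; in the third case functions are moved to the front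
    -- because they are central among the polyvector fields. Two derivations would give a bivector
    -- and are excluded by `hxy`.
    rcases x with a | X <;> rcases y with b | Y
    · exact ⟨Sum.inl (a * b), rfl, by simp [xiLetter]⟩
    · exact ⟨Sum.inr (a • Y), rfl, by simp [xiLetter, Algebra.smul_def]⟩
    · exact ⟨Sum.inr (b • X), rfl, by simp [xiLetter, ← Algebra.commutes, Algebra.smul_def]⟩
    · simp at hxy
  obtain ⟨z, hz, hz'⟩ := hz
  -- The sign in `suspMul` is that of the degree in $V$, the negative of the desuspended parity;
  -- hence the coefficient `-c`.
  have : suspMul (polyvecDeg K A) (xiLetter x) (xiLetter y) = -c • xiLetter z := by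
    simp [suspMul, hc, hz']
  rw [this, map_smul, smul_mul_assoc]
  exact Submodule.smul_mem _ _ (ι_mul_mem_xiFil hw (by omega))

/-- Merging neighbours preserves the number of derivations as long as two derivations never meet,
which `n ≤ 2` guarantees. All levels up to `2` are needed for the induction: behind a derivation,
the rest of the word has to be handled at a lower level. -/
theorem harr_mem_xiFil (l : List (A ⊕ Derivation K A A)) (n : ℕ) (hn : n ≤ 2)
    (h : derCount l < n) :
    harr (suspParity (polyvecDeg K A)) (suspMul (polyvecDeg K A)) (xiWord l) ∈ xiFil K A n := by
  induction l generalizing n with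
  | nil => rw [xiWord_nil, harr_one]; exact zero_mem _
  | cons x l ih =>
    obtain ⟨c, hc⟩ := suspParity_xiLetter x
    rw [xiWord_cons, harr_cons, hc, map_smul, smul_mul_assoc]
    rw [derCount_cons] at h
    -- In the term that keeps the first letter, the tail is estimated at level `n - derCount [x]`,
    -- and `x` restores what was subtracted. By `h` the truncated subtraction is a genuine one.
    refine add_mem ?_ (Submodule.smul_mem _ _
      (ι_mul_mem_xiFil (ih (n - derCount [x]) (by omega) (by omega)) (by omega)))
    cases l with
    | nil => rw [xiWord_nil, headMap_one]; exact zero_mem _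
    | cons y l =>
      rw [derCount_cons y] at h
      rw [xiWord_cons, headMap_cons]
      -- The remaining word is placed at its exact level `derCount l + 1`. As `n ≤ 2`, the letters
      -- `x` and `y` contain at most one derivation together.
      exact suspMul_mul_mem_xiFil (xiWord_mem (Nat.lt_succ_self _)) (by omega) (by omega)

/-! ### The Schouten bracket on words. -/

variable [CharZero K]

/-- Contraction of two letters lowers the number of derivations by one. -/
theorem schouten_mul_mem_xiFil {x y : A ⊕ Derivation K A A} {w : TensorAlgebra K (Polyvec K A)}
    {m n : ℕ} (hw : w ∈ xiFil K A n) (h : derCount [x] + derCount [y] + n ≤ m + 1) :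
    ι K (schouten K A (xiLetter x) (xiLetter y)) * w ∈ xiFil K A m := by
  rcases x with a | X <;> rcases y with b | Y
  -- For two functions the target level may be one below that of `w`, so the vanishing of $[a,b]$ is
  -- essential.
  · simp [xiLetter, schouten_spec.alg_alg]
  -- Graded antisymmetry has the sign $(-1)^{(0+1)(1+1)}=1$ here, so $[a,Y]=-[Y,a]=-Y(a)$.
  · have : schouten K A (xiLetter (Sum.inl a)) (xiLetter (Sum.inr Y)) =
        -xiLetter (Sum.inl (Y a)) := by
      simp [xiLetter, schouten_spec.antisymm 0 1 _ _ (alg_mem a) (ι_mem Y), schouten_spec.der_alg]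
    rw [this, map_neg, neg_mul]
    exact neg_mem (ι_mul_mem_xiFil hw (by simp at h ⊢; omega))
  · have : schouten K A (xiLetter (Sum.inr X)) (xiLetter (Sum.inl b)) = xiLetter (Sum.inl (X b)) :=
      schouten_spec.der_alg X b
    rw [this]
    exact ι_mul_mem_xiFil hw (by simp at h ⊢; omega)
  · have : schouten K A (xiLetter (Sum.inr X)) (xiLetter (Sum.inr Y)) = xiLetter (Sum.inr ⁅X, Y⁆) :=
      schouten_spec.der_der X Y
    rw [this]
    exact ι_mul_mem_xiFil hw (by simp at h ⊢; omega)

/-- As for `passLetter`, both parity components give multiples of a single term, here the contracted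
letter $[x,y]$ in front of the value of `G`; the contraction gains one level. -/
theorem contractLetter_mem_xiFil
    {G : TensorAlgebra K (Polyvec K A) →ₗ[K] TensorAlgebra K (Polyvec K A)}
    {l : List (A ⊕ Derivation K A A)} {n m : ℕ} (hG : G (xiWord l) ∈ xiFil K A n)
    (x y : A ⊕ Derivation K A A) (h : derCount [x] + derCount [y] + n ≤ m + 1) :
    contractLetter (suspParity (polyvecDeg K A)) (schouten K A) (xiLetter y) G (xiLetter x)
      (xiWord l) ∈ xiFil K A m := by
  obtain ⟨c, hc⟩ := evPart_xiLetter y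
  obtain ⟨d, hd⟩ := odPart_xiLetter y
  obtain ⟨e, he⟩ := par_xiWord l
  simp only [contractLetter, LinearMap.mk₂_apply, hc, hd, he, map_smul, smul_mul_assoc,
    mul_smul_comm]
  exact add_mem (Submodule.smul_mem _ _ (schouten_mul_mem_xiFil hG h))
    (Submodule.smul_mem _ _ (Submodule.smul_mem _ _ (schouten_mul_mem_xiFil hG h)))

/-- Every term of the bracket is a shuffle with exactly one contraction, which costs one derivation.
Compared with `shuffle_mem_xiFil` the bound therefore improves by one, and the $+1$ of the strict
inequality disappears. For `derCount l + derCount m = 0` it even says that the bracket is zero. -/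
theorem wordBracket_mem_xiFil (l m : List (A ⊕ Derivation K A A)) (n : ℕ)
    (h : derCount l + derCount m ≤ n) :
    wordBracket (suspParity (polyvecDeg K A)) (schouten K A) (xiWord l) (xiWord m) ∈
      xiFil K A n := by
  induction m generalizing l n with
  | nil => rw [xiWord_nil, wordBracket_one]; exact zero_mem _
  | cons y m ih =>
    rw [xiWord_cons, wordBracket_cons_right]
    -- The first sum leaves `y` uncontracted and postpones the contraction to the bracket with `m`,
    -- covered by the induction hypothesis. In the second one `y` is contracted with the first
    -- letter of a suffix `l'`, after which only shuffles occur.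
    refine add_mem (tailSum_mem_xiFil (fun l' n' h' => passLetter_mem_xiFil
      (by rw [LinearMap.flip_apply]; exact ih l' _ le_rfl) y ?_)
      l n h) (tailSum_mem_xiFil (fun l' n' h' => ?_) l n h)
    · rw [derCount_cons] at h'; omega
    · cases l' with
      -- An empty suffix offers no letter with which `y` could be contracted.
      | nil => rw [xiWord_nil, headMap_one]; exact zero_mem _
      | cons x l' =>
        rw [xiWord_cons, headMap_cons]
        -- The shuffle of the two remainders has level `derCount l' + (derCount m + 1)`; the level
        -- gained by contracting `x` with `y` cancels this $+1$.
        refine contractLetter_mem_xiFil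
          (by rw [LinearMap.flip_apply]; exact shuffle_mem_xiFil l' m _ le_rfl) x y ?_
        rw [derCount_cons, derCount_cons y] at h'; omega

end XiWords

/-! ### The DG Lie subalgebra of the cofree Lie coalgebra. -/

section XiColie
variable {K A : Type*} [Field K] [CommRing A] [Algebra K A]

/-- Level `2` means at most one derivation. As the operations on $L$ are induced by those on words,
their stability can thus be checked on representatives. -/
theorem mkQ_mem_colieXi {w : TensorAlgebra K (Polyvec K A)} (hw : w ∈ xiFil K A 2) :
    Submodule.mkQ (shuffleSpan (suspParity (polyvecDeg K A))) w ∈ colieXi K A := by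
  induction hw using Submodule.span_induction with
  | mem w hw =>
    obtain ⟨l, hl, rfl⟩ := hw
    exact Submodule.subset_span ⟨l, Nat.le_of_lt_succ hl, rfl⟩
  | zero => rw [map_zero]; exact zero_mem _
  | add a b _ _ ha hb => rw [map_add]; exact add_mem ha hb
  | smul c a _ ha => rw [map_smul]; exact Submodule.smul_mem _ _ ha

variable [CharZero K]

/-- Stability under the parity is needed because the Chevalley–Eilenberg recursion expresses its
signs through this operator. -/
theorem colieParity_mem_colieXi {X : BarColie (polyvecDeg K A)} (hX : X ∈ colieXi K A) :
    colieParity (polyvecDeg K A) X ∈ colieXi K A := by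
  induction hX using Submodule.span_induction with
  | mem w hw =>
    obtain ⟨l, hl, rfl⟩ := hw
    obtain ⟨c, hc⟩ := par_xiWord l
    rw [colieParity_mk]
    refine mkQ_mem_colieXi ?_
    -- The product in the definition of `colieXi` is `xiWord l` by definition.
    change par _ (xiWord l) ∈ _
    rw [hc]
    exact Submodule.smul_mem _ _ (xiWord_mem (Nat.lt_succ_of_le hl))
  | zero => rw [map_zero]; exact zero_mem _
  | add a b _ _ ha hb => rw [map_add]; exact add_mem ha hb
  | smul c a _ ha => rw [map_smul]; exact Submodule.smul_mem _ _ ha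

theorem colieDiff_mem_colieXi {X : BarColie (polyvecDeg K A)} (hX : X ∈ colieXi K A) :
    (polyvecGerstenhaber K A).colieDiff X ∈ colieXi K A := by
  induction hX using Submodule.span_induction with
  | mem w hw =>
    obtain ⟨l, hl, rfl⟩ := hw
    rw [Gerstenhaber.colieDiff_mk]
    exact mkQ_mem_colieXi (harr_mem_xiFil l 2 le_rfl (Nat.lt_succ_of_le hl))
  | zero => rw [map_zero]; exact zero_mem _
  | add a b _ _ ha hb => rw [map_add]; exact add_mem ha hb
  | smul c a _ ha => rw [map_smul]; exact Submodule.smul_mem _ _ ha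

/-- This is the point where $1+1-1=1$ enters: two words with one derivation each may be bracketed
without leaving the subspace. -/
theorem colieBracket_mem_colieXi {X Y : BarColie (polyvecDeg K A)} (hX : X ∈ colieXi K A)
    (hY : Y ∈ colieXi K A) : (polyvecGerstenhaber K A).colieBracket X Y ∈ colieXi K A := by
  induction hX, hY using Submodule.span_induction₂ with
  | mem_mem X Y hX hY =>
    obtain ⟨l, hl, rfl⟩ := hX
    obtain ⟨m, hm, rfl⟩ := hY
    rw [Gerstenhaber.colieBracket_mk]
    exact mkQ_mem_colieXi (wordBracket_mem_xiFil l m 2 (Nat.add_le_add hl hm))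
  | zero_left Y _ => rw [map_zero, LinearMap.zero_apply]; exact zero_mem _
  | zero_right X _ => rw [map_zero]; exact zero_mem _
  | add_left X X' Y _ _ _ h h' => rw [map_add, LinearMap.add_apply]; exact add_mem h h'
  | add_right X Y Y' _ _ _ h h' => rw [map_add]; exact add_mem h h'
  | smul_left c X Y _ _ h => rw [map_smul, LinearMap.smul_apply]; exact Submodule.smul_mem _ _ h
  | smul_right c X Y _ _ h => rw [map_smul]; exact Submodule.smul_mem _ _ h

end XiColie

/-! ### The Chevalley–Eilenberg codifferential on symmetric products from a stable subspace. -/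

section SymProducts
variable {K L : Type*} [Field K] [AddCommGroup L] [Module K L] (σ : L →ₗ[K] L) (M : Submodule K L)

/-- The span of all symmetric products of elements of `M`. -/
def symProd : Submodule K (SuspSym σ) :=
  Submodule.span K {c | ∃ l : List L, (∀ x ∈ l, x ∈ M) ∧ c = (l.map (symι σ)).prod}

/-- The span of the nonempty symmetric products of elements of `M`. -/
def posSymProd : Submodule K (SuspSym σ) :=
  Submodule.span K {c | ∃ l : List L, l ≠ [] ∧ (∀ x ∈ l, x ∈ M) ∧ c = (l.map (symι σ)).prod}

variable {σ M}

theorem posSymProd_le : posSymProd σ M ≤ symProd σ M :=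
  Submodule.span_mono fun _ ⟨l, _, h, hc⟩ => ⟨l, h, hc⟩

/-- Both recursions for the codifferential produce terms of the form generator times product. The
product may be empty, but the generator in front keeps the result in the coalgebra without counit;
this is why two spans are distinguished. -/
theorem symι_mul_mem_posSymProd {x : L} (hx : x ∈ M) {w : SuspSym σ} (hw : w ∈ symProd σ M) :
    symι σ x * w ∈ posSymProd σ M := by
  induction hw using Submodule.span_induction with
  | mem w hw =>
    obtain ⟨l, hl, rfl⟩ := hw
    exact Submodule.subset_span ⟨x :: l, by simp, by simpa using ⟨hx, hl⟩, by simp⟩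
  | zero => simp
  | add a b _ _ ha hb => rw [mul_add]; exact add_mem ha hb
  | smul c a _ ha => rw [mul_smul_comm]; exact Submodule.smul_mem _ _ ha

variable [CharZero K] (hσ : ∀ x, σ (σ x) = x) {br : L →ₗ[K] L →ₗ[K] L}
  (hbr : ∀ x y, σ (br x y) = br (σ x) (σ y))

/-- Contracting `x` with one factor replaces that factor by a bracket in `M`, and the others change
by signs at most. The element `x` varies in the induction since the signs also call for the
contraction with `σ x`. -/
theorem adSym_mem_posSymProd (hσM : ∀ x ∈ M, σ x ∈ M) (hbrM : ∀ x ∈ M, ∀ y ∈ M, br x y ∈ M)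
    (l : List L) (hl : ∀ x ∈ l, x ∈ M) {x : L} (hx : x ∈ M) :
    adSym hσ hbr (l.map (symι σ)).prod x ∈ posSymProd σ M := by
  induction l generalizing x with
  | nil => rw [List.map_nil, List.prod_nil, adSym, recS_one]; exact zero_mem _
  | cons y l ih =>
    rw [List.forall_mem_cons] at hl
    -- Elements of `M` need not be homogeneous; stability under `σ` puts their even and odd parts
    -- into `M`.
    have hev : evPart σ y ∈ M := Submodule.smul_mem _ _ (add_mem hl.1 (hσM y hl.1))
    have hod : odPart σ y ∈ M := Submodule.smul_mem _ _ (sub_mem hl.1 (hσM y hl.1))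
    have hw : (l.map (symι σ)).prod ∈ symProd σ M := Submodule.subset_span ⟨l, hl.2, rfl⟩
    rw [List.map_cons, List.prod_cons, adSym, recS_cons]
    -- The recursion `recS` is folded back into `adSym`, so that the induction hypothesis applies.
    change adStep br y (_, adSym hσ hbr _) x ∈ _
    simp only [adStep, LinearMap.mk₂_apply, LinearMap.add_apply, LinearMap.neg_apply,
      LinearMap.comp_apply, LinearMap.mulRight_apply, LinearMap.mulLeft_apply, LinearMap.flip_apply]
    -- With $w$ the product over `l`, the three terms are $-[\sigma x,y]\,w$, then
    -- $y_{\mathrm{odd}}\,\mathrm{ad}_x w$ and $y_{\mathrm{even}}\,\mathrm{ad}_{\sigma x}w$.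
    exact add_mem (add_mem (neg_mem (symι_mul_mem_posSymProd (hbrM _ (hσM x hx) y hl.1) hw))
      (symι_mul_mem_posSymProd hod (posSymProd_le (ih hl.2 hx))))
      (symι_mul_mem_posSymProd hev (posSymProd_le (ih hl.2 (hσM x hx))))

/-- The Chevalley-Eilenberg codifferential preserves the symmetric products of elements of a
differential graded Lie subalgebra. -/
theorem dSym_mem_posSymProd (hba : ∀ p q x y, σ x = (-1 : K) ^ p • x → σ y = (-1 : K) ^ q • y →
      br x y = -((-1 : K) ^ (p * q) • br y x))
    {δ : L →ₗ[K] L} (hδ : ∀ x, σ (δ x) = -δ (σ x)) (hσM : ∀ x ∈ M, σ x ∈ M)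
    (hbrM : ∀ x ∈ M, ∀ y ∈ M, br x y ∈ M) (hδM : ∀ x ∈ M, δ x ∈ M)
    (l : List L) (hl : ∀ x ∈ l, x ∈ M) :
    dSym hσ hbr hba hδ (l.map (symι σ)).prod ∈ posSymProd σ M := by
  induction l with
  -- The codifferential annihilates the empty product, so the induction may start there and still
  -- end in nonempty products.
  | nil => rw [List.map_nil, List.prod_nil, dSym, recS_one]; exact zero_mem _
  | cons x l ih =>
    rw [List.forall_mem_cons] at hl
    have hw : (l.map (symι σ)).prod ∈ symProd σ M := Submodule.subset_span ⟨l, hl.2, rfl⟩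
    rw [List.map_cons, List.prod_cons, dSym_cons]
    -- One stability assumption for each term of $d(xw)=(\delta x)w-(\sigma x)\,dw+\mathrm{ad}_x w$.
    exact add_mem (sub_mem (symι_mul_mem_posSymProd (hδM x hl.1) hw)
      (symι_mul_mem_posSymProd (hσM x hl.1) (posSymProd_le (ih hl.2))))
      (adSym_mem_posSymProd hσ hbr hσM hbrM l hl.2 hl.1)

end SymProducts

/-! ### Application to the bar construction. -/

theorem mem_Xi_of_mem_posSymProd {K A : Type*} [Field K] [CharZero K] [CommRing A] [Algebra K A]
    {ξ : BarE2 (polyvecDeg K A)}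
    (h : ξ.1 ∈ posSymProd (colieParity (polyvecDeg K A)) (colieXi K A)) : ξ ∈ Xi K A := by
  -- The span `Xi` lives in the subspace `BarE2`, whereas `posSymProd` lives in the whole symmetric
  -- algebra. It suffices to compare them on generators, inside the image of `Xi` under the
  -- inclusion; injectivity of the inclusion then returns the element itself.
  have key : ∀ c ∈ posSymProd (colieParity (polyvecDeg K A)) (colieXi K A),
      c ∈ (Xi K A).map (posSym (colieParity (polyvecDeg K A))).subtype := by
    intro c hc
    refine Submodule.span_le.2 ?_ hc
    rintro _ ⟨l, hne, hl, rfl⟩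
    -- Nonemptiness is what makes the product an element of `BarE2`.
    obtain ⟨x, l, rfl⟩ := List.exists_cons_of_ne_nil hne
    refine ⟨⟨((x :: l).map (symι _)).prod, ?_⟩, Submodule.subset_span ⟨x :: l, hne, hl, rfl⟩, rfl⟩
    rw [List.map_cons, List.prod_cons]
    exact symι_mul_mem x _
  obtain ⟨η, hη, hηξ⟩ := key _ h
  exact (Subtype.ext hηξ : η = ξ) ▸ hη

end Gerst

theorem mainTheorem8 (K A : Type*) [Field K] [CharZero K] [CommRing A] [Algebra K A] :
    ∀ ξ ∈ Gerst.Xi K A, (Gerst.polyvecGerstenhaber K A).codifferential ξ ∈ Gerst.Xi K A := by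
  intro ξ hξ
  induction hξ using Submodule.span_induction with
  | mem ξ hξ =>
    obtain ⟨l, -, hl, hξ⟩ := hξ
    refine Gerst.mem_Xi_of_mem_posSymProd ?_
    -- The codifferential is a restriction of `dSym`, so the claim becomes one about `dSym` on a
    -- product of elements of `colieXi`.
    rw [Gerst.Gerstenhaber.codifferential, LinearMap.coe_restrict_apply, hξ]
    exact Gerst.dSym_mem_posSymProd _ _ _ _ (fun _ => Gerst.colieParity_mem_colieXi)
      (fun _ hX _ hY => Gerst.colieBracket_mem_colieXi hX hY)
      (fun _ => Gerst.colieDiff_mem_colieXi) l hl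
  | zero => rw [map_zero]; exact zero_mem _
  | add a b _ _ ha hb => rw [map_add]; exact add_mem ha hb
  | smul c a _ ha => rw [map_smul]; exact Submodule.smul_mem _ _ ha
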